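/- **Setting.** Fix a finite node set $V$; node $u$ has a unique numerical identifier $id(u)$, and there is a distance measure $dist$ on identifiers with $dist(b,b)<dist(a,b)$ for $a\ne b$. In a distributed protocol every node has a local memory (a set of references of nodes and other variables), an unbounded unordered channel, finitely many guarded actions (one of them, Timeout, always enabled), and an action for every message. A computation is an infinite sequence of atomic steps from an arbitrary state, with weakly fair action execution and fair message receipt. There is an explicit edge $(u,v)$ if $u$ stores the reference of $v$, and an implicit one if a message in the channel of $u$ carries it. A protocol *self-stabilizes* to a digraph $T$ on $V$, with a set $L$ of legitimate states, if in every state of $L$ the explicit edges are exactly those of $T$, every computation from a weakly connected state (explicit and implicit edges) reaches $L$, and $L$ is closed under steps. Loops are disregarded. **Primitives.** $\mathcal{P}_{IDF}$ is the class of protocols for which, in every action of a node $u$, messages go only to nodes of which $u$ holds a reference, and the handling of references is a sequence of uses of: *Introduction* ($u$ sends the reference of $w$ to $v\neq w$ and keeps it), *Delegation* ($u$ sends the reference of $w$ to $v$ and deletes it; $u,v,w$ distinct), *Fusion* (of two copies of the same reference). In $\mathcal{P}_{ISF}$ every node $u$ also stores a sequence number $u.eseq[w]$ for each reference and divides its explicit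 edges, as a function of its local memory, into stable and temporary ones; Delegation is replaced by *Safe-Delegation*: implicit edges are delegated as before; for a temporary edge $(u,w)$, $u$ may send DelegateREQ$(u,w,u.eseq[w])$ to a stable neighbour $v$, setting $u.eseq[v]:=\max(u.eseq[v],u.eseq[w]+1)$; a node $v$ that receives DelegateREQ$(u,w,n)$ stores $w$, sets $v.eseq[w]:=\max(v.eseq[w],n+1)$ and sends DelegateACK$(w,n)$ to $u$; a node $u$ that receives DelegateACK$(w,n)$ with $n=u.eseq[w]$ and $(u,w)$ temporary removes this edge and sends ImplDelegate$(w)$ to a neighbour, and otherwise acts as upon receipt of ImplDelegate$(w)$. Explicit edges are removed in no other way, and sequence numbers are changed, and DelegateREQ/DelegateACK messages sent, in no other way. **MDL property** (for $T$, $L$, $dist$): (i) a node $u$ executing an action while holding the reference of $v$ keeps it if $(u,v)\in T$; (ii) if in some computation $u$ executes an action while holding the reference of $v$ and does not keep it, then no later action of $u$ keeps it; (iii) whether and where references are sent is determined by the local memory (including the message being processed); (iv) from a legitimate state on, every reference of $v$ in a message in the channel of $u\ne v$ is forwarded along fixed cycle-free paths, as long as it has not reached a node that keeps a reference of $v$;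 (v) an edge $(u,w)$ is delegated only to nodes $v$ such that $dist(id(v),x)<dist(id(u),x)$ for every target identifier $x$ with $dist(id(w),x)<dist(id(u),x)$. The *stable* MDL property is the same with "keeps" meaning "keeps as a stable edge". **Invariants** of a state. 1: If DelegateREQ$(u,w,n)$ is in the channel of $v$, then $u.eseq[w]>n$, or there is a path of explicit edges from $u$ to $v$ that does not contain $(u,w)$ and has $x.eseq[y]>u.eseq[w]$ for each of its edges $(x,y)$. 2: If DelegateACK$(w,n)$ is in the channel of $u$, then $u.eseq[w]>n$, or there is such a path from $u$ to $w$. **Theorem.** There is a transformation $A\mapsto B$ of protocols such that, whenever $A\in\mathcal{P}_{IDF}$ self-stabilizes to a strongly connected topology $T$ and has the MDL property, the following holds: $B\in\mathcal{P}_{ISF}$; $B$ self-stabilizes to the same topology $T$ and has the stable MDL property (with respect to a suitable set of legitimate states of $B$); and every computation of $B$ has a suffix in which Invariants 1 and 2 hold in every state. -/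

import Mathlib

open Relation

namespace Overlay

section Model

/-- Local memory of a node: the stored references (to nodes of the fixed node set `V`) and all
other protocol variables.  Every set of references may be stored. -/
structure LocalState (V Var : Type) where
  refs : Finset V
  var : Var

/-- What triggers the execution of an action: the guard of a guarded action, or a message. -/
inductive Trigger (Act Msg : Type) where
  | guarded (a : Act)
  | message (m : Msg)

/-- Result of an atomic action: the new local memory, and the messages that are sent, each
together with its recipient. -/
structure Outcome (V Var Msg : Type) where
  next : LocalState V Var
  sends : Multiset (V × Msg)

/-- The code of a distributed protocol.  Every node has finitely many guarded actions, whose guards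
are predicates over its local memory, one of them the action `timeout` with guard `true`, and a
procedure for every message.  Actions only see the local memory of the executing node and the
message that is processed; they need not be deterministic. -/
structure Program (V Var Msg : Type) where
  Act : Type
  finite_act : Finite Act
  timeout : Act
  guard : V → Act → LocalState V Var → Prop
  guard_timeout : ∀ u s, guard u timeout s
  run : V → Trigger Act Msg → LocalState V Var → Outcome V Var Msg → Prop
  run_guarded : ∀ u a s, guard u a s → ∃ o, run u (.guarded a) s o
  run_message : ∀ u m s, ∃ o, run u (.message m) s o

/-- A distributed protocol: its variables, its messages with the references that they carry
(with multiplicity), and its code. -/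
structure Protocol (V : Type) where
  Var : Type
  nonempty_var : Nonempty Var
  Msg : Type
  refsOf : Msg → Multiset V
  prog : Program V Var Msg

variable {V : Type} [DecidableEq V]

namespace Protocol

variable (P : Protocol V)

abbrev Local : Type := LocalState V P.Var

abbrev Trig : Type := Trigger P.prog.Act P.Msg

abbrev Out : Type := Outcome V P.Var P.Msg

/-- System states: the local memories, and the (unordered, unbounded) channels of incoming
messages. -/
structure State where
  loc : V → P.Local
  ch : V → Multiset P.Msg

/-- `o` is a possible result of the action of `u` that is triggered by `t`. -/
def Yields (u : V) (t : P.Trig) (s : P.Local) (o : P.Out) : Prop :=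
  (match t with
    | .guarded a => P.prog.guard u a s
    | .message _ => True) ∧ P.prog.run u t s o

/-- The message that is removed from the channel, if any. -/
def consumed : P.Trig → Multiset P.Msg
  | .guarded _ => 0
  | .message m => {m}

/-- The references that come with the trigger. -/
def triggerRefs : P.Trig → Multiset V
  | .guarded _ => 0
  | .message m => P.refsOf m

/-- The messages of an outcome that are sent to `v`. -/
def sentTo (o : P.Out) (v : V) : Multiset P.Msg :=
  (o.sends.filter (fun p => p.1 = v)).map Prod.snd

/-- Pairs (recipient, reference), one for every reference that is sent. -/
def sentRefs (o : P.Out) : Multiset (V × V) :=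
  o.sends.bind (fun p => (P.refsOf p.2).map (fun w => (p.1, w)))

/-- An atomic step: node `u` executes the enabled action that is triggered by `t`. -/
def StepBy (u : V) (t : P.Trig) (S S' : P.State) : Prop :=
  ∃ (o : P.Out) (rest : Multiset P.Msg),
    P.Yields u t (S.loc u) o ∧
    S.ch u = P.consumed t + rest ∧
    S'.loc = Function.update S.loc u o.next ∧
    S'.ch = fun v => Function.update S.ch u rest v + P.sentTo o v

def Step (S S' : P.State) : Prop := ∃ u t, P.StepBy u t S S'

def Reachable : P.State → P.State → Prop := ReflTransGen P.Step

/-- Computations: infinite sequences of steps with weakly fair action execution and fair message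
receipt.  The initial state is arbitrary. -/
structure Computation where
  state : ℕ → P.State
  node : ℕ → V
  trig : ℕ → P.Trig
  step : ∀ i, P.StepBy (node i) (trig i) (state i) (state (i + 1))
  weakly_fair : ∀ (u : V) (a : P.prog.Act),
    (∃ N, ∀ i, N ≤ i → P.prog.guard u a ((state i).loc u)) →
      ∀ N, ∃ i, N ≤ i ∧ node i = u ∧ trig i = .guarded a
  fair_receipt : ∀ (i : ℕ) (u : V) (m : P.Msg), m ∈ (state i).ch u →
    ∃ j, i ≤ j ∧ node j = u ∧ trig j = .message m

/-- Explicit edges between different nodes. -/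
def ENG (S : P.State) (u v : V) : Prop := u ≠ v ∧ v ∈ (S.loc u).refs

/-- Explicit or implicit edges between different nodes. -/
def NG (S : P.State) (u v : V) : Prop :=
  u ≠ v ∧ (v ∈ (S.loc u).refs ∨ ∃ m ∈ S.ch u, v ∈ P.refsOf m)

def WeaklyConnected (S : P.State) : Prop := ∀ u v, EqvGen (P.NG S) u v

/-- Self-stabilization to the static topology `T`, with `L` as the set of legitimate states:
in legitimate states the explicit edges are those of `T`, every computation from a weakly connected
state arrives at a legitimate state, and legitimate states are never left.  (Loops of `T` and
references of a node to itself are disregarded.) -/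
structure SelfStabilizesTo (T : Digraph V) (L : Set P.State) : Prop where
  topology : ∀ S ∈ L, ∀ u v, P.ENG S u v ↔ u ≠ v ∧ T.Adj u v
  convergence : ∀ C : P.Computation, P.WeaklyConnected (C.state 0) → ∃ i, C.state i ∈ L
  closure : ∀ S ∈ L, ∀ S', P.Step S S' → S' ∈ L

/-- The references that `u` holds while it executes an action: its own one, the stored ones, and
those in the message that is processed. -/
def held (u : V) (t : P.Trig) (s : P.Local) : Multiset V :=
  u ::ₘ ((s.refs.erase u).val + (P.triggerRefs t).filter (fun w => w ≠ u))

end Protocol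

/-- Strong connectivity of a topology. -/
def StronglyConnected (T : Digraph V) : Prop := ∀ u v, ReflTransGen T.Adj u v

/-- `v` is closer than `u` to every target identifier for which a search may traverse the edge
`(u, w)`, i.e. for which this edge decreases the distance to the target. -/
def Closer (ident : V → ℕ) (dist : ℕ → ℕ → ℝ) (u v w : V) : Prop :=
  ∀ target : ℕ, dist (ident w) target < dist (ident u) target →
    dist (ident v) target < dist (ident u) target

end Model

section IDF

variable {V : Type} [DecidableEq V]

/-- One use of a primitive of `IDF` by `u`.  A configuration consists of the references that `u`
holds and of the pairs (recipient, reference) sent so far.  `D v w` says that the reference of `w`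
may be delegated to `v`. -/
inductive IDFStep (u : V) (D : V → V → Prop) :
    Multiset V × Multiset (V × V) → Multiset V × Multiset (V × V) → Prop
  | introduction (v w : V) (h : Multiset V) (out : Multiset (V × V)) :
      v ∈ h → w ∈ h → v ≠ w → IDFStep u D (h, out) (h, (v, w) ::ₘ out)
  | delegation (v w : V) (h : Multiset V) (out : Multiset (V × V)) :
      v ∈ h → w ∈ h → u ≠ v → u ≠ w → v ≠ w → D v w →
        IDFStep u D (h, out) (h.erase w, (v, w) ::ₘ out)
  | fusion (v : V) (h : Multiset V) (out : Multiset (V × V)) :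
      2 ≤ h.count v → IDFStep u D (h, out) (h.erase v, out)

namespace Protocol

variable (P : Protocol V)

/-- The action with outcome `o` only sends messages to nodes of which `u` holds a reference, and what
it does with references is a sequence of uses of Introduction, Delegation and Fusion. -/
def IDFDecomposable (D : V → V → Prop) (u : V) (t : P.Trig) (s : P.Local) (o : P.Out) : Prop :=
  (∀ p ∈ o.sends, p.1 ∈ P.held u t s) ∧
  ReflTransGen (IDFStep u D) (P.held u t s, 0) (u ::ₘ (o.next.refs.erase u).val, P.sentRefs o)

/-- Membership in the class of protocols that are built from `IDF`. -/
def InPIDF : Prop :=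
  ∀ u t s o, P.Yields u t s o → P.IDFDecomposable (fun _ _ => True) u t s o

end Protocol

end IDF

section MDL

variable {V : Type} [DecidableEq V]

namespace Protocol

variable (P : Protocol V) (keep : V → P.Local → Finset V)

/-- `q` is a message (with its recipient) that carries the reference of `v` and is sent when `p` is
processed in some state reachable from `S` by a node that does not keep a reference of `v`. -/
def Forwards (S : P.State) (v : V) (p q : V × P.Msg) : Prop :=
  ∃ S', P.Reachable S S' ∧ p.2 ∈ S'.ch p.1 ∧ v ∈ P.refsOf p.2 ∧ v ∉ keep p.1 (S'.loc p.1) ∧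
    ∃ o, P.Yields p.1 (.message p.2) (S'.loc p.1) o ∧ q ∈ o.sends ∧ v ∈ P.refsOf q.2

/-- Conditions (i)-(iv) of the MDL property.  `keep u s` is the set of references that count as kept
by `u` in memory `s`: all stored ones for the MDL property, the stable ones for the stable MDL
property. -/
structure MDLCore (T : Digraph V) (L : Set P.State) : Prop where
  /-- (i) References that belong to the final topology are always kept. -/
  keeps_topology : ∀ C : P.Computation, ∀ i v, v ≠ C.node i →
    v ∈ P.held (C.node i) (C.trig i) ((C.state i).loc (C.node i)) → T.Adj (C.node i) v →
    v ∈ keep (C.node i) ((C.state (i + 1)).loc (C.node i))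
  /-- (ii) Once a node has decided not to keep a reference, all its later actions do so. -/
  monotone : ∀ C : P.Computation, ∀ i j v, i < j → C.node i = C.node j → v ≠ C.node i →
    v ∈ P.held (C.node i) (C.trig i) ((C.state i).loc (C.node i)) →
    v ∉ keep (C.node i) ((C.state (i + 1)).loc (C.node i)) →
    v ∈ P.held (C.node j) (C.trig j) ((C.state j).loc (C.node j)) →
    v ∉ keep (C.node j) ((C.state (j + 1)).loc (C.node j))
  /-- (iii) Whether and where references are sent is determined by the local memory (and the
  message that is processed). -/
  deterministic : ∀ u t s o o', P.Yields u t s o → P.Yields u t s o' → P.sentRefs o = P.sentRefs o'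
  /-- (iv) In legitimate states, the reference of `v` in a message `m` in the channel of `u` travels
  on cycle-free paths ... -/
  cycle_free : ∀ S ∈ L, ∀ u m v, m ∈ S.ch u → v ∈ P.refsOf m → v ≠ u →
    ∀ q r, ReflTransGen (P.Forwards keep S v) (u, m) q → TransGen (P.Forwards keep S v) q r →
      q.1 ≠ r.1
  /-- ... that are fixed: as long as it has not reached a node that keeps a reference of `v`, it is
  sent on to the nodes of a nonempty set that does not depend on the moment. -/
  fixed_paths : ∀ S ∈ L, ∀ u m v, m ∈ S.ch u → v ∈ P.refsOf m → v ≠ u →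
    ∀ q, ReflTransGen (P.Forwards keep S v) (u, m) q → q.1 ≠ v ∧
      ∃ N : Set V, N.Nonempty ∧
        ∀ S', P.Reachable S S' → q.2 ∈ S'.ch q.1 → v ∉ keep q.1 (S'.loc q.1) →
          ∀ o, P.Yields q.1 (.message q.2) (S'.loc q.1) o → ∀ y, (y, v) ∈ P.sentRefs o ↔ y ∈ N

/-- The MDL property of a protocol built from `IDF`; the second part is condition (v). -/
def MDL (ident : V → ℕ) (dist : ℕ → ℕ → ℝ) (T : Digraph V) (L : Set P.State) : Prop :=
  P.MDLCore (fun _ s => s.refs) T L ∧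
  ∀ u t s o, P.Yields u t s o → P.IDFDecomposable (Closer ident dist u) u t s o

end Protocol

end MDL

section ISF

/-- Messages of protocols with Safe-Delegation: `req u w n` is the message DelegateREQ(u,w,n),
`ack w n` is DelegateACK(w,n), `impl w` is ImplDelegate(w), each with a mark that carries no
references, and `other p` are all further messages. -/
inductive SafeMsg (V Mark Payload : Type) where
  | req (u w : V) (n : ℕ) (k : Mark)
  | ack (w : V) (n : ℕ) (k : Mark)
  | impl (w : V) (k : Mark)
  | other (p : Payload)

/-- What is sent, up to marks: a reference in a message of type `other`, or one of the three
messages of Safe-Delegation. -/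
inductive Parcel (V : Type) where
  | ref (w : V)
  | impl (w : V)
  | req (u w : V) (n : ℕ)
  | ack (w : V) (n : ℕ)

namespace SafeMsg

variable {V Mark Payload : Type} (payloadRefs : Payload → Multiset V)

def refsOf : SafeMsg V Mark Payload → Multiset V
  | req u w _ _ => {u, w}
  | ack w _ _ => {w}
  | impl w _ => {w}
  | other p => payloadRefs p

def parcels : SafeMsg V Mark Payload → Multiset (Parcel V)
  | req u w n _ => {Parcel.req u w n}
  | ack w n _ => {Parcel.ack w n}
  | impl w _ => {Parcel.impl w}
  | other p => (payloadRefs p).map Parcel.ref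

end SafeMsg

/-- A protocol whose nodes store a sequence number `eseq` for every reference and divide the stored
references into stable and temporary ones, as a function of their local memory. -/
structure SafeProtocol (V : Type) where
  Var : Type
  nonempty_var : Nonempty Var
  Mark : Type
  nonempty_mark : Nonempty Mark
  Payload : Type
  payloadRefs : Payload → Multiset V
  prog : Program V ((V → ℕ) × Var) (SafeMsg V Mark Payload)
  stable : V → LocalState V ((V → ℕ) × Var) → Finset V
  stable_subset : ∀ u s, stable u s ⊆ s.refs

/-- Configurations of a node `u` within an action: the explicit references (other than its own one),
the references from the message being processed that are still to be dealt with, the sequence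
numbers, and what has been sent so far. -/
structure SafeConf (V : Type) where
  expl : Finset V
  impl : Multiset V
  eseq : V → ℕ
  out : Multiset (V × Parcel V)

variable {V : Type} [DecidableEq V]

/-- `u` has a reference of `v`. -/
def SafeConf.Knows (u : V) (c : SafeConf V) (v : V) : Prop := v = u ∨ v ∈ c.expl ∨ v ∈ c.impl

/-- One use of a primitive of `ISF` by `u`, apart from the reactions to DelegateREQ and DelegateACK.
`st` is the set of stable references; `D v w` says that the reference of `w` may be delegated
to `v`. -/
inductive ISFStep (u : V) (st : Finset V) (D : V → V → Prop) : SafeConf V → SafeConf V → Prop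
  | introduction (c : SafeConf V) (v w : V) (p : Parcel V) :
      c.Knows u v → c.Knows u w → v ≠ w → (p = .ref w ∨ p = .impl w) →
        ISFStep u st D c { c with out := (v, p) ::ₘ c.out }
  /-- An implicit edge is delegated as in the Delegation primitive. -/
  | implicitDelegation (c : SafeConf V) (v w : V) (p : Parcel V) :
      c.Knows u v → w ∈ c.impl → u ≠ v → u ≠ w → v ≠ w → (p = .ref w ∨ p = .impl w) → D v w →
        ISFStep u st D c { c with impl := c.impl.erase w, out := (v, p) ::ₘ c.out }
  /-- Delegation of a temporary edge `(u, w)` starts with a request to a stable neighbour `v`. -/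
  | request (c : SafeConf V) (v w : V) :
      v ∈ c.expl → v ∈ st → w ∈ c.expl → w ∉ st → D v w →
        ISFStep u st D c
          { c with
            eseq := Function.update c.eseq v (max (c.eseq v) (c.eseq w + 1))
            out := (v, .req u w (c.eseq w)) ::ₘ c.out }
  /-- A received reference is stored; if it is stored already, this is a Fusion. -/
  | store (c : SafeConf V) (w : V) :
      w ∈ c.impl → w ≠ u →
        ISFStep u st D c { c with expl := insert w c.expl, impl := c.impl.erase w }
  /-- Fusion of two received references, or of a received reference with the own one. -/
  | fusion (c : SafeConf V) (w : V) :
      w ∈ c.impl → (w = u ∨ 2 ≤ c.impl.count w) →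
        ISFStep u st D c { c with impl := c.impl.erase w }

namespace SafeProtocol

variable (B : SafeProtocol V)

/-- The underlying distributed protocol. -/
abbrev toProtocol : Protocol V where
  Var := (V → ℕ) × B.Var
  nonempty_var := ⟨(fun _ => 0, B.nonempty_var.some)⟩
  Msg := SafeMsg V B.Mark B.Payload
  refsOf := SafeMsg.refsOf B.payloadRefs
  prog := B.prog

abbrev Local : Type := LocalState V ((V → ℕ) × B.Var)

abbrev Trig : Type := Trigger B.prog.Act (SafeMsg V B.Mark B.Payload)

abbrev Out : Type := Outcome V ((V → ℕ) × B.Var) (SafeMsg V B.Mark B.Payload)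

/-- The sequence number `u.eseq[w]` in the local memory `s` of `u`. -/
def eseq (s : B.Local) (w : V) : ℕ := s.var.1 w

/-- The edge `(u, w)` is temporary. -/
def Temporary (u : V) (s : B.Local) (w : V) : Prop := w ≠ u ∧ w ∈ s.refs ∧ w ∉ B.stable u s

/-- The configuration in which the references of `m` have just been received. -/
def received (u : V) (s : B.Local) (impl : Multiset V) : SafeConf V :=
  ⟨s.refs.erase u, impl, B.eseq s, 0⟩

/-- The condition under which DelegateACK(w,n) makes `u` remove the edge `(u, w)`. -/
def AckValid (u : V) (s : B.Local) (w : V) (n : ℕ) : Prop := n = B.eseq s w ∧ B.Temporary u s w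

/-- `c` is the configuration of `u` after the reaction to the trigger that Safe-Delegation
prescribes. -/
def Start (D : V → V → Prop) (u : V) (s : B.Local) : B.Trig → SafeConf V → Prop
  | .guarded _, c => c = B.received u s 0
  | .message (.other p), c => c = B.received u s (B.payloadRefs p)
  | .message (.impl w _), c => c = B.received u s {w}
  /- `w` becomes an explicit neighbour and `x` gets an acknowledgement; the reference of `x` serves to
  send it and need not be used any further. -/
  | .message (.req x w n _), c =>
      ∃ impl : Multiset V, (impl = {x} ∨ impl = 0) ∧
        c = ⟨(insert w s.refs).erase u, impl,
          Function.update (B.eseq s) w (max (B.eseq s w) (n + 1)), {(x, .ack w n)}⟩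
  /- A valid acknowledgement turns the temporary edge into an implicit one, which is delegated to some
  neighbour; any other one is handled like ImplDelegate(w). -/
  | .message (.ack w n _), c =>
      (B.AckValid u s w n ∧ ∃ v ∈ s.refs, v ≠ u ∧ v ≠ w ∧ D v w ∧
        c = ⟨(s.refs.erase w).erase u, 0, B.eseq s, {(v, .impl w)}⟩) ∨
      (¬ B.AckValid u s w n ∧ c = B.received u s {w})

/-- What is sent in an outcome, up to marks. -/
def sentParcels (o : B.Out) : Multiset (V × Parcel V) :=
  o.sends.bind (fun p => (SafeMsg.parcels B.payloadRefs p.2).map (fun q => (p.1, q)))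

/-- The action with outcome `o` only sends messages to nodes of which `u` holds a reference, and what
it does with references, sequence numbers and the messages of Safe-Delegation is a sequence of uses
of Introduction, Safe-Delegation and Fusion. -/
def ISFDecomposable (D : V → V → Prop) (u : V) (t : B.Trig) (s : B.Local) (o : B.Out) : Prop :=
  (∀ p ∈ o.sends, p.1 ∈ B.toProtocol.held u t s) ∧
  ∃ c, B.Start D u s t c ∧
    ReflTransGen (ISFStep u (B.stable u o.next) D) c
      ⟨o.next.refs.erase u, 0, B.eseq o.next, B.sentParcels o⟩

/-- Membership in the class of protocols that are built from `ISF`.  The second condition says that a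
DelegateACK(w,n) that is not valid is handled like ImplDelegate(w). -/
def InPISF : Prop :=
  (∀ u t s o, B.toProtocol.Yields u t s o → B.ISFDecomposable (fun _ _ => True) u t s o) ∧
  ∀ u s w n k, ¬ B.AckValid u s w n → ∃ k', ∀ o,
    B.toProtocol.Yields u (.message (.ack w n k)) s o →
      B.toProtocol.Yields u (.message (.impl w k')) s o

/-- The stable MDL property: the MDL property with respect to stable edges. -/
def StableMDL (ident : V → ℕ) (dist : ℕ → ℕ → ℝ) (T : Digraph V) (L : Set B.toProtocol.State) :
    Prop :=
  B.toProtocol.MDLCore B.stable T L ∧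
  ∀ u t s o, B.toProtocol.Yields u t s o → B.ISFDecomposable (Closer ident dist u) u t s o

/-- There is a path of explicit edges from `a` to `b` that does not contain `(u, w)` and on which all
sequence numbers are larger than `u.eseq[w]`. -/
def SafePath (S : B.toProtocol.State) (u w a b : V) : Prop :=
  ReflTransGen (fun x y => B.toProtocol.ENG S x y ∧ (x, y) ≠ (u, w) ∧
    B.eseq (S.loc u) w < B.eseq (S.loc x) y) a b

/-- The message invariant for DelegateREQ. -/
def Invariant1 (S : B.toProtocol.State) : Prop :=
  ∀ v u w n k, SafeMsg.req u w n k ∈ S.ch v → B.SafePath S u w u v ∨ n < B.eseq (S.loc u) w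

/-- The message invariant for DelegateACK. -/
def Invariant2 (S : B.toProtocol.State) : Prop :=
  ∀ u w n k, SafeMsg.ack w n k ∈ S.ch u → B.SafePath S u w u w ∨ n < B.eseq (S.loc u) w

end SafeProtocol

end ISF

end Overlay

/-! The transformation sees only `A`, not `T`, so the topology has to be read off the code. Call a
reference permanent at `u` if no action of `u`, in any memory, gives it up (`permanent`).
Computations start in arbitrary states, so condition (i) makes every edge of `T` permanent.
Conversely, a computation that starts with all explicit edges still has the permanent ones when it
becomes legitimate, so they belong to `T` (`mem_permanent_iff`).

The same computation shows that `T` is greedily routable (`exists_closer_permanent`). Whenever `u`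
loses a reference, it has been delegated to a node that is closer in the sense of (v), and `Closer`
is transitive. Hence for every `w` outside the neighbourhood of `u` some neighbour in `T` is
`Closer` than `u`. Taking it as next hop strictly decreases the distance to `w`.

The protocol `B` depends on `A` only through these neighbourhoods `N` and next hops. A node hoards
all references, as stable edges, until it has its whole target neighbourhood. From then on its other
edges are temporary and are passed to the next hop by Safe-Delegation, and newly received references
are forwarded. On Timeout it probes its neighbours, and a probe is answered with all known
references.

Two facts carry the proof. Delegations die out, by induction along the distance to the delegated
node (`eventually_quiet`); from then on there are no requests and no acknowledgements, and both
invariants hold vacuously. Moreover, a node that hoarded forever would learn every reference in its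
weak component, hence its target neighbourhood (`exists_target_subset`). Together they give
convergence. In legitimate states a reference moves along next hops only, which gives fixed
cycle-free paths. -/

namespace Overlay

namespace Protocol

/-! ### Existence of fair computations, and draining of channels. -/

section Scheduling

set_option linter.unusedSectionVars false

variable {V : Type} [DecidableEq V] {P : Protocol V}

variable (P) in
/-- The action of `u` that is triggered by `t` can be executed in `S`. -/
def Enabled (S : P.State) (u : V) : P.Trig → Prop
  | .guarded a => P.prog.guard u a (S.loc u)
  | .message m => m ∈ S.ch u

theorem exists_yields (u : V) (t : P.Trig) (s : P.Local)
    (h : ∀ a, t = .guarded a → P.prog.guard u a s) : ∃ o, P.Yields u t s o := by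
  cases t with
  | guarded a =>
    obtain ⟨o, ho⟩ := P.prog.run_guarded u a s (h a rfl)
    exact ⟨o, h a rfl, ho⟩
  | message m =>
    obtain ⟨o, ho⟩ := P.prog.run_message u m s
    exact ⟨o, trivial, ho⟩

theorem exists_stepBy_of_enabled {S : P.State} {u : V} {t : P.Trig} (h : P.Enabled S u t) :
    ∃ S', P.StepBy u t S S' := by
  obtain ⟨o, ho⟩ := exists_yields u t (S.loc u) (by rintro a rfl; exact h)
  have hrest : ∃ rest, S.ch u = P.consumed t + rest := by
    cases t with
    | guarded a => exact ⟨S.ch u, by simp [consumed]⟩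
    | message m =>
      obtain ⟨r, hr⟩ := Multiset.exists_cons_of_mem h
      exact ⟨r, by simp [consumed, hr]⟩
  obtain ⟨rest, hr⟩ := hrest
  exact ⟨⟨_, _⟩, o, rest, ho, hr, rfl, rfl⟩

theorem StepBy.mem_ch {u v : V} {t : P.Trig} {S S' : P.State} (h : P.StepBy u t S S') {m : P.Msg}
    (hm : m ∈ S.ch v) : (u = v ∧ t = .message m) ∨ m ∈ S'.ch v := by
  obtain ⟨o, rest, -, hch, -, hch'⟩ := h
  rw [hch']
  by_cases huv : v = u
  · subst huv
    rw [hch, Multiset.mem_add] at hm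
    rcases hm with hm | hm
    · cases t with
      | guarded a => simp [consumed] at hm
      | message m' =>
        simp only [consumed, Multiset.mem_singleton] at hm
        exact .inl ⟨rfl, by rw [hm]⟩
    · right; simp [hm]
  · right; simp [huv, hm]

/-- Finiteness lets a round-robin schedule serve all currently enabled actions within one finite
round. -/
theorem finite_enabled [Finite V] (S : P.State) :
    {τ : V × P.Trig | P.Enabled S τ.1 τ.2}.Finite := by
  have := P.prog.finite_act
  have h1 : (Set.range fun x : V × P.prog.Act => (x.1, (Trigger.guarded x.2 : P.Trig))).Finite :=
    Set.finite_range _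
  have h2 : (⋃ u : V, (fun m => (u, (Trigger.message m : P.Trig))) '' {m | m ∈ S.ch u}).Finite :=
    Set.finite_iUnion fun u => (Multiset.finite_toSet (S.ch u)).image _
  refine (h1.union h2).subset ?_
  rintro ⟨u, t⟩ h
  cases t with
  | guarded a => exact .inl ⟨(u, a), rfl⟩
  | message m => exact .inr (Set.mem_iUnion.2 ⟨u, m, h, rfl⟩)

/-- A finite nonempty agenda that contains every enabled action. -/
theorem exists_agenda [Finite V] [Nonempty V] (S : P.State) :
    ∃ p : (V × P.Trig) × List (V × P.Trig), ∀ τ : V × P.Trig, P.Enabled S τ.1 τ.2 →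
      τ ∈ p.1 :: p.2 := by
  obtain ⟨u⟩ := ‹Nonempty V›
  refine ⟨((u, .guarded P.prog.timeout), (finite_enabled S).toFinset.toList), fun τ h => ?_⟩
  simp [h]

/-- A scheduled task is executed if it is enabled, and replaced by Timeout otherwise. -/
theorem exists_execution (S : P.State) (τ : V × P.Trig) :
    ∃ p : P.Trig × P.State, P.StepBy τ.1 p.1 S p.2 ∧ (P.Enabled S τ.1 τ.2 → p.1 = τ.2) := by
  by_cases h : P.Enabled S τ.1 τ.2
  · obtain ⟨S', h'⟩ := exists_stepBy_of_enabled h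
    exact ⟨(τ.2, S'), h', fun _ => rfl⟩
  · obtain ⟨S', h'⟩ := exists_stepBy_of_enabled (S := S) (u := τ.1)
      (t := .guarded P.prog.timeout) (P.prog.guard_timeout _ _)
    exact ⟨(_, S'), h', fun h'' => absurd h'' h⟩

/-- From every state there is a computation. -/
theorem exists_computation [Finite V] [Nonempty V] (S : P.State) :
    ∃ C : P.Computation, C.state 0 = S := by
  choose agenda hagenda using exists_agenda (P := P)
  choose exec hstep hexec using exists_execution (P := P)
  -- A configuration is the state, the current task and the queue of the round; once the queue is
  -- empty, the next round is filled with everything then enabled.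
  let next : P.State × (V × P.Trig) × List (V × P.Trig) →
      P.State × (V × P.Trig) × List (V × P.Trig) := fun c =>
    ((exec c.1 c.2.1).2, match c.2.2 with
      | [] => agenda (exec c.1 c.2.1).2
      | τ :: l => (τ, l))
  let cfg : ℕ → P.State × (V × P.Trig) × List (V × P.Trig) := fun n => next^[n] (S, agenda S)
  have hcfg : ∀ n, cfg (n + 1) = next (cfg n) := fun n => Function.iterate_succ_apply' _ _ _
  have hqueue : ∀ (l : List (V × P.Trig)) (i : ℕ), (cfg i).2.2 = l → ∀ τ ∈ l,
      ∃ j, i ≤ j ∧ (cfg j).2.1 = τ := by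
    intro l
    induction l with
    | nil => simp
    | cons a l ih =>
      intro i hi τ hτ
      have h1 : (cfg (i + 1)).2 = (a, l) := by rw [hcfg]; simp only [next, hi]
      rcases List.mem_cons.1 hτ with rfl | hτ
      · exact ⟨i + 1, by omega, by rw [h1]⟩
      · obtain ⟨j, hj, h⟩ := ih (i + 1) (by rw [h1]) τ hτ
        exact ⟨j, by omega, h⟩
  have hempty : ∀ (l : List (V × P.Trig)) (i : ℕ), (cfg i).2.2 = l →
      ∃ j, i ≤ j ∧ (cfg j).2.2 = [] := by
    intro l
    induction l with
    | nil => exact fun i hi => ⟨i, le_rfl, hi⟩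
    | cons a l ih =>
      intro i hi
      obtain ⟨j, hj, h⟩ := ih (i + 1) (by rw [hcfg]; simp only [next, hi])
      exact ⟨j, by omega, h⟩
  -- Every time is followed by the start of a round, and whatever is enabled there gets its turn.
  have hround : ∀ i, ∃ j, i ≤ j ∧ ∀ τ : V × P.Trig, P.Enabled (cfg j).1 τ.1 τ.2 →
      ∃ k, j ≤ k ∧ (cfg k).2.1 = τ := by
    intro i
    obtain ⟨j, hj, hjn⟩ := hempty _ i rfl
    have h1 : (cfg (j + 1)).2 = agenda (cfg (j + 1)).1 := by rw [hcfg]; simp only [next, hjn]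
    refine ⟨j + 1, by omega, fun τ hτ => ?_⟩
    have h2 := hagenda _ τ hτ
    rw [← h1] at h2
    rcases List.mem_cons.1 h2 with h2 | h2
    · exact ⟨j + 1, le_rfl, h2.symm⟩
    · exact hqueue _ _ rfl τ h2
  have hst : ∀ i, P.StepBy (cfg i).2.1.1 (exec (cfg i).1 (cfg i).2.1).1 (cfg i).1
      (cfg (i + 1)).1 := by
    intro i
    rw [hcfg]
    exact hstep _ _
  refine ⟨⟨fun i => (cfg i).1, fun i => (cfg i).2.1.1, fun i => (exec (cfg i).1 (cfg i).2.1).1,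
    hst, ?_, ?_⟩, rfl⟩
  · rintro u a ⟨N, hN⟩ M
    obtain ⟨j, hj, h⟩ := hround (max N M)
    obtain ⟨k, hk, hkτ⟩ := h (u, .guarded a) (hN j (by omega))
    refine ⟨k, by omega, by simp [hkτ], ?_⟩
    rw [hexec _ _ (by rw [hkτ]; exact hN k (by omega)), hkτ]
  · intro i u m hm
    by_contra hcon
    push Not at hcon
    -- A message that is never processed stays in the channel, so it is on the agenda of the next
    -- round and still enabled at its turn.
    have hpers : ∀ j, i ≤ j → m ∈ (cfg j).1.ch u := by
      intro j hj
      induction j, hj using Nat.le_induction with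
      | base => exact hm
      | succ j hj ih =>
        rcases (hst j).mem_ch ih with h | h
        · exact absurd h.2 (hcon j hj h.1)
        · exact h
    obtain ⟨j, hj, h⟩ := hround i
    obtain ⟨k, hk, hkτ⟩ := h (u, .message m) (hpers j hj)
    refine hcon k (by omega) (by simp [hkτ]) ?_
    rw [hexec _ _ (by rw [hkτ]; exact hpers k (by omega)), hkτ]

/-- Every step is the first step of a computation. -/
theorem StepBy.exists_computation [Finite V] {u : V} {t : P.Trig} {S S' : P.State}
    (h : P.StepBy u t S S') : ∃ C : P.Computation,
      C.state 0 = S ∧ C.state 1 = S' ∧ C.node 0 = u ∧ C.trig 0 = t := by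
  have : Nonempty V := ⟨u⟩
  obtain ⟨C, rfl⟩ := Protocol.exists_computation S'
  refine ⟨⟨fun i => i.casesOn S C.state, fun i => i.casesOn u C.node,
    fun i => i.casesOn t C.trig, ?_, ?_, ?_⟩, rfl, rfl, rfl, rfl⟩
  · rintro (_ | i)
    exacts [h, C.step i]
  · rintro v a ⟨N, hN⟩ M
    obtain ⟨i, hi, h1, h2⟩ := C.weakly_fair v a ⟨N, fun i hi => hN (i + 1) (by omega)⟩ M
    exact ⟨i + 1, by omega, h1, h2⟩
  · rintro (_ | i) v m hm
    · rcases h.mem_ch hm with ⟨rfl, rfl⟩ | hm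
      · exact ⟨0, le_rfl, rfl, rfl⟩
      · obtain ⟨j, -, h1, h2⟩ := C.fair_receipt 0 v m hm
        exact ⟨j + 1, by omega, h1, h2⟩
    · obtain ⟨j, hj, h1, h2⟩ := C.fair_receipt i v m hm
      exact ⟨j + 1, by omega, h1, h2⟩

/-- If no more messages with property `p` are sent to `u`, there are none left after a while. -/
theorem Computation.eventually_drained (C : P.Computation) (u : V) (p : P.Msg → Prop)
    (h : ∃ N, ∀ i, N ≤ i → ∃ rest o, (C.state i).ch u = (if C.node i = u then
      P.consumed (C.trig i) else 0) + rest ∧ (C.state (i + 1)).ch u = rest + o ∧ ∀ m ∈ o, ¬ p m) :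
    ∃ N, ∀ i, N ≤ i → ∀ m ∈ (C.state i).ch u, ¬ p m := by
  classical
  obtain ⟨N, hN⟩ := h
  -- The number of messages with property `p` never grows after time `N`, and drops whenever one of
  -- them is received; fair receipt then forces it to zero.
  have hstep : ∀ i, N ≤ i → (((C.state (i + 1)).ch u).filter p).card ≤
      (((C.state i).ch u).filter p).card ∧ ∀ m, p m → C.node i = u → C.trig i = .message m →
      (((C.state (i + 1)).ch u).filter p).card < (((C.state i).ch u).filter p).card := by
    intro i hi
    obtain ⟨rest, o, h1, h2, h3⟩ := hN i hi
    have h4 : o.filter p = 0 := Multiset.filter_eq_nil.2 h3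
    rw [h1, h2, Multiset.filter_add, Multiset.filter_add, h4]
    refine ⟨by simp, fun m hm hu ht => ?_⟩
    simp [hu, ht, consumed, hm, Multiset.filter_singleton]
  have hmono : ∀ i j, N ≤ i → i ≤ j → (((C.state j).ch u).filter p).card ≤
      (((C.state i).ch u).filter p).card := by
    intro i j hi hj
    induction j, hj using Nat.le_induction with
    | base => exact le_rfl
    | succ j hj ih => exact ((hstep j (by omega)).1).trans ih
  have key : ∀ n i, N ≤ i → (((C.state i).ch u).filter p).card = n →
      ∃ N, ∀ i, N ≤ i → ∀ m ∈ (C.state i).ch u, ¬ p m := by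
    intro n
    induction n using Nat.strong_induction_on with
    | _ n ih =>
      intro i hi hn
      by_cases h : ∃ m ∈ (C.state i).ch u, p m
      · obtain ⟨m, hm, hpm⟩ := h
        obtain ⟨j, hj, h1, h2⟩ := C.fair_receipt i u m hm
        have h3 := (hstep j (by omega)).2 m hpm h1 h2
        have h4 := hmono i j hi hj
        exact ih _ (by omega) (j + 1) (by omega) rfl
      · push Not at h
        refine ⟨i, fun j hj m hm hpm => ?_⟩
        have h0 : (((C.state i).ch u).filter p) = 0 := Multiset.filter_eq_nil.2 h
        have h1 := hmono i j hi hj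
        rw [h0, Multiset.card_zero, Nat.le_zero, Multiset.card_eq_zero] at h1
        exact Multiset.filter_eq_nil.1 h1 m hm hpm
  exact key _ N le_rfl rfl

end Scheduling

end Protocol

/-! ### Reading a greedily routable topology off the protocol `A`. -/

theorem Closer.trans {V : Type} {ident : V → ℕ} {dist : ℕ → ℕ → ℝ} {u v v' w : V}
    (h : Closer ident dist u v w) (h' : Closer ident dist u v' v) : Closer ident dist u v' w :=
  fun t ht => h' t (h t ht)

/-- Among the references of `u` that survive a sequence of primitives there is always one that
a reference held before may have been delegated to. -/
theorem IDFStep.survives {V : Type} [DecidableEq V] {u : V} {D : V → V → Prop}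
    (hD : ∀ v v' w, D v w → D v' v → D v' w) {c c' : Multiset V × Multiset (V × V)}
    (h : ReflTransGen (IDFStep u D) c c') :
    ∀ w ∈ c.1, w ∈ c'.1 ∨ ∃ v ∈ c'.1, v ≠ u ∧ D v w := by
  induction h using ReflTransGen.head_induction_on with
  | refl => exact fun w hw => .inl hw
  | head hstep _ ih =>
    intro x hx
    cases hstep with
    | introduction v w h out _ _ _ => exact ih x hx
    | delegation v w h out hv hw huv huw hvw hvwD =>
      by_cases hxw : x = w
      · subst hxw
        -- The recipient `v` of a delegated reference is itself still held; if it is given up later,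
        -- transitivity of `D` passes to its surviving substitute.
        rcases ih v ((Multiset.mem_erase_of_ne hvw).2 hv) with h1 | ⟨v', h1, h2, h3⟩
        · exact .inr ⟨v, h1, huv.symm, hvwD⟩
        · exact .inr ⟨v', h1, h2, hD _ _ _ hvwD h3⟩
      · exact ih x ((Multiset.mem_erase_of_ne hxw).2 hx)
    | fusion v h out hv =>
      refine ih x ?_
      by_cases hxv : x = v
      · subst hxv
        rw [← Multiset.count_pos, Multiset.count_erase_self]
        omega
      · exact (Multiset.mem_erase_of_ne hxv).2 hx

namespace Protocol

variable {V : Type} [DecidableEq V]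

theorem mem_held_of_mem_refs {P : Protocol V} {u w : V} {t : P.Trig} {s : P.Local}
    (h : w ∈ s.refs) : w ∈ P.held u t s := by
  by_cases hw : w = u
  · simp [held, hw]
  · simp [held, h, hw, -Finset.erase_val]

set_option linter.unusedSectionVars false

variable [Fintype V]

open Classical in
/-- The references to other nodes that no action of `u` ever gives up. -/
noncomputable def permanent (A : Protocol V) (u : V) : Finset V :=
  {w | w ≠ u ∧ ∀ t s o, A.Yields u t s o → w ∈ A.held u t s → w ∈ o.next.refs}

theorem mem_permanent {A : Protocol V} {u w : V} : w ∈ A.permanent u ↔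
    w ≠ u ∧ ∀ t s o, A.Yields u t s o → w ∈ A.held u t s → w ∈ o.next.refs := by
  simp [permanent]

theorem notMem_permanent_self (A : Protocol V) (u : V) : u ∉ A.permanent u := by
  simp [permanent]

variable {A : Protocol V} {T : Digraph V} {L : Set A.State}

/-- There is a computation that starts with all explicit edges. -/
theorem exists_complete_computation (A : Protocol V) [Nonempty V] :
    ∃ C : A.Computation, ∀ u w, w ∈ ((C.state 0).loc u).refs := by
  obtain ⟨C, hC⟩ := exists_computation (P := A)
    ⟨fun _ => ⟨Finset.univ, A.nonempty_var.some⟩, fun _ => 0⟩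
  exact ⟨C, fun u w => by simp [hC]⟩

theorem SelfStabilizesTo.exists_of_complete (hA : A.SelfStabilizesTo T L) {C : A.Computation}
    (hC : ∀ u w, w ∈ ((C.state 0).loc u).refs) : ∃ i, C.state i ∈ L :=
  hA.convergence C fun u v => by
    by_cases h : u = v
    · subst h; exact .refl _
    · exact .rel _ _ ⟨h, .inl (hC u v)⟩

theorem Computation.loc_succ {P : Protocol V} (C : P.Computation) (i : ℕ) (u : V) :
    (C.node i ≠ u ∧ (C.state (i + 1)).loc u = (C.state i).loc u) ∨
    ∃ o, P.Yields u (C.trig i) ((C.state i).loc u) o ∧ (C.state (i + 1)).loc u = o.next := by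
  obtain ⟨o, rest, hy, -, hl, -⟩ := C.step i
  by_cases h : C.node i = u
  · subst h
    exact .inr ⟨o, hy, by rw [hl, Function.update_self]⟩
  · exact .inl ⟨h, by rw [hl, Function.update_of_ne (Ne.symm h)]⟩

/-- The permanent references of a self-stabilizing protocol with the MDL property are those that
belong to its topology. -/
theorem mem_permanent_iff (hA : A.SelfStabilizesTo T L)
    (hm : A.MDLCore (fun _ s => s.refs) T L) {u w : V} :
    w ∈ A.permanent u ↔ u ≠ w ∧ T.Adj u w := by
  have : Nonempty V := ⟨u⟩
  constructor
  · intro h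
    rw [mem_permanent] at h
    obtain ⟨C, hC⟩ := exists_complete_computation A
    obtain ⟨i, hi⟩ := hA.exists_of_complete hC
    have key : ∀ i, w ∈ ((C.state i).loc u).refs := by
      intro i
      induction i with
      | zero => exact hC u w
      | succ i ih =>
        rcases C.loc_succ i u with ⟨-, h1⟩ | ⟨o, h1, h1'⟩
        · rw [h1]; exact ih
        · rw [h1']
          exact h.2 _ _ _ h1 (mem_held_of_mem_refs ih)
    exact (hA.topology _ hi u w).1 ⟨h.1.symm, key i⟩
  · rintro ⟨huw, hT⟩
    rw [mem_permanent]
    refine ⟨huw.symm, fun t s o hy hw => ?_⟩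
    -- Any memory and trigger occur in the first step of some computation: give every node the
    -- memory `s`, and its channel just the message to be consumed, if any.
    obtain ⟨C, h0, h1, h2, h3⟩ := StepBy.exists_computation (P := A) (u := u) (t := t)
      (S := ⟨fun _ => s, fun _ => A.consumed t⟩)
      (S' := ⟨Function.update (fun _ => s) u o.next, fun v =>
        Function.update (fun _ => A.consumed t) u 0 v + A.sentTo o v⟩)
      ⟨o, 0, hy, by simp, rfl, rfl⟩
    subst h2 h3
    have := hm.keeps_topology C 0 w huw.symm (by rw [h0]; exact hw) hT
    simpa [h1] using this

/-- From every node `u`, the search for any other node may proceed along a permanent edge. -/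
theorem exists_closer_permanent {ident : V → ℕ} {dist : ℕ → ℕ → ℝ}
    (hA : A.SelfStabilizesTo T L) (hm : A.MDL ident dist T L) {u w : V} (huw : w ≠ u)
    (hw : w ∉ A.permanent u) : ∃ v ∈ A.permanent u, Closer ident dist u v w := by
  have : Nonempty V := ⟨u⟩
  obtain ⟨C, hC⟩ := exists_complete_computation A
  obtain ⟨i, hi⟩ := hA.exists_of_complete hC
  -- Backward induction from the legitimate state, where all references are permanent. At time 0
  -- every reference is stored, so the claim then covers all `w`.
  have key : ∀ k j, j + k = i → ∀ w ≠ u, w ∈ ((C.state j).loc u).refs →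
      w ∈ A.permanent u ∨ ∃ v ∈ A.permanent u, Closer ident dist u v w := by
    intro k
    induction k with
    | zero =>
      rintro j rfl w hwu hwr
      exact .inl ((mem_permanent_iff hA hm.1).2 ((hA.topology _ hi u w).1 ⟨hwu.symm, hwr⟩))
    | succ k ih =>
      intro j hj w hwu hwr
      specialize ih (j + 1) (by omega)
      rcases C.loc_succ j u with ⟨-, h1⟩ | ⟨o, h1, h1'⟩
      · exact ih w hwu (by rw [h1]; exact hwr)
      · rw [h1'] at ih
        have h2 := (hm.2 _ _ _ _ h1).2
        rcases IDFStep.survives (fun _ _ _ h h' => h.trans h') h2 w (mem_held_of_mem_refs hwr) with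
          h3 | ⟨v, h3, hvu, hvw⟩
        · refine ih w hwu ?_
          simpa [hwu, -Finset.erase_val] using h3
        · rcases ih v hvu (by simpa [hvu, -Finset.erase_val] using h3) with h4 | ⟨v', h4, h5⟩
          · exact .inr ⟨v, h4, hvw⟩
          · exact .inr ⟨v', h4, hvw.trans h5⟩
  exact (key i 0 (by omega) w huw (hC u w)).resolve_left hw

end Protocol

/-! ### A protocol that builds a given greedily routable topology with Safe-Delegation -/

namespace Routed

section Definitions

variable {V : Type} [DecidableEq V]

abbrev Memory (V : Type) : Type := LocalState V ((V → ℕ) × Unit)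

/-- The mark of ImplDelegate tells whether the recipient has to introduce its neighbours. -/
abbrev Message (V : Type) : Type := SafeMsg V Bool Empty

abbrev Result (V : Type) : Type := Outcome V ((V → ℕ) × Unit) (Message V)

variable (N : V → Finset V) (hop : V → V → V) (u : V) (s : Memory V)

/-- A node that does not know all its target neighbours yet considers all its edges stable. -/
def stable : Finset V := if N u ⊆ s.refs then s.refs ∩ N u else s.refs

def temporary : Finset V := s.refs.erase u \ stable N u s

/-- The references that are stored after the reference of `w` has been received. -/
def absorb (w : V) : Finset V := if N u ⊆ s.refs then s.refs else insert w s.refs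

/-- A received reference that is not stored is sent on to the next hop. -/
def forward (w : V) : Multiset (V × Message V) :=
  if N u ⊆ s.refs ∧ w ∉ N u ∧ w ≠ u then {(hop u w, .impl w false)} else 0

/-- All known references are introduced to `w`. -/
def reply (w : V) : Multiset (V × Message V) :=
  ((insert u s.refs).erase w).val.map fun z => (w, .impl z false)

/-- The node introduces itself to all its neighbours and asks for their references. -/
def probes : Multiset (V × Message V) :=
  (s.refs.erase u).val.map fun z => (z, .impl u true)

def requests : Multiset (V × Message V) :=
  (temporary N u s).val.map fun w => (hop u w, .req u w (s.var.1 w) false)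

/-- The sequence numbers after requests for the edges to `W`. -/
def raise (W : Finset V) (v : V) : ℕ :=
  max (s.var.1 v) ((W.filter fun w => hop u w = v).sup fun w => s.var.1 w + 1)

def onTimeout : Result V :=
  ⟨⟨s.refs, raise hop u s (temporary N u s), ()⟩, requests N hop u s + probes u s⟩

def onImpl (w : V) (probe : Bool) : Result V :=
  ⟨⟨absorb N u s w, s.var⟩, forward N hop u s w + if probe then reply u s w else 0⟩

def onReq (x w : V) (n : ℕ) : Result V :=
  ⟨⟨insert w (absorb N u s x), Function.update s.var.1 w (max (s.var.1 w) (n + 1)), ()⟩,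
    forward N hop u s x + {(x, .ack w n false)}⟩

def onAck (w : V) (n : ℕ) : Result V :=
  if n = s.var.1 w ∧ w ∈ temporary N u s then ⟨⟨s.refs.erase w, s.var⟩, forward N hop u s w⟩
  else onImpl N hop u s w false

def react : Trigger Unit (Message V) → Result V
  | .guarded _ => onTimeout N hop u s
  | .message (.req x w n _) => onReq N hop u s x w n
  | .message (.ack w n _) => onAck N hop u s w n
  | .message (.impl w probe) => onImpl N hop u s w probe
  | .message (.other p) => p.elim

theorem stable_subset : stable N u s ⊆ s.refs := by
  unfold stable
  split_ifs
  exacts [Finset.inter_subset_left, subset_rfl]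

/-- The protocol with target topology `N` in which `hop u w` is the neighbour to which `u` delegates
its edge to `w`. -/
abbrev safeProtocol : SafeProtocol V where
  Var := Unit
  nonempty_var := inferInstance
  Mark := Bool
  nonempty_mark := inferInstance
  Payload := Empty
  payloadRefs := Empty.elim
  prog :=
    { Act := Unit
      finite_act := inferInstance
      timeout := ()
      guard := fun _ _ _ => True
      guard_timeout := fun _ _ => trivial
      run := fun u t s o => o = react N hop u s t
      run_guarded := fun _ _ _ _ => ⟨_, rfl⟩
      run_message := fun _ _ _ => ⟨_, rfl⟩ }
  stable := stable N
  stable_subset := stable_subset N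

end Definitions

/-- Every edge that does not belong to the topology `N` can be delegated along a next hop. -/
structure IsRouting {V : Type} (N : V → Finset V) (hop : V → V → V)
    (D : V → V → V → Prop) : Prop where
  irrefl : ∀ u, u ∉ N u
  mem : ∀ u w, w ≠ u → w ∉ N u → hop u w ∈ N u
  delegable : ∀ u w, w ≠ u → w ∉ N u → D u (hop u w) w

/-! ### Realizing the reactions by the primitives of `ISF`. -/

section Primitives

set_option linter.unusedSectionVars false

variable {V : Type} [DecidableEq V] {N : V → Finset V} {hop : V → V → V} {D : V → V → V → Prop}
  {u w : V} {s : Memory V}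

theorem mem_temporary : w ∈ temporary N u s ↔ N u ⊆ s.refs ∧ w ≠ u ∧ w ∈ s.refs ∧ w ∉ N u := by
  unfold temporary stable
  split_ifs with h
  · simp only [Finset.mem_sdiff, Finset.mem_erase, Finset.mem_inter, h, true_and]
    tauto
  · simp only [Finset.mem_sdiff, Finset.mem_erase, h, false_and, iff_false]
    tauto

theorem mem_absorb_of_mem {v : V} (h : v ∈ s.refs) : v ∈ absorb N u s w := by
  unfold absorb
  split_ifs
  exacts [h, Finset.mem_insert_of_mem h]

theorem mem_absorb_or (hw : w ≠ u) : w ∈ absorb N u s w ∨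
    N u ⊆ s.refs ∧ w ∉ N u ∧ forward N hop u s w = {(hop u w, .impl w false)} := by
  unfold absorb forward
  by_cases h : N u ⊆ s.refs
  · by_cases h' : w ∈ N u
    · simp [h, h h']
    · simp [h, h', hw]
  · simp [h]

theorem mem_forward {p : V × Message V} (h : p ∈ forward N hop u s w) :
    N u ⊆ s.refs ∧ w ∉ N u ∧ w ≠ u ∧ p = (hop u w, .impl w false) := by
  unfold forward at h
  split_ifs at h with h'
  · exact ⟨h'.1, h'.2.1, h'.2.2, by simpa using h⟩
  · simp at h

/-- The parcels of a collection of messages. -/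
def parcels (M : Multiset (V × Message V)) : Multiset (V × Parcel V) :=
  M.bind fun p => (SafeMsg.parcels Empty.elim p.2).map fun q => (p.1, q)

theorem parcels_add (M M' : Multiset (V × Message V)) :
    parcels (M + M') = parcels M + parcels M' := Multiset.add_bind _ _ _

theorem parcels_forward : parcels (forward N hop u s w) =
    if N u ⊆ s.refs ∧ w ∉ N u ∧ w ≠ u then {(hop u w, .impl w)} else 0 := by
  unfold forward
  split_ifs <;> simp [parcels, SafeMsg.parcels]

theorem parcels_reply :
    parcels (reply u s w) = ((insert u s.refs).erase w).val.map fun z => (w, .impl z) := by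
  simp [parcels, reply, SafeMsg.parcels, Multiset.bind_map, Multiset.bind_singleton]

theorem parcels_probes :
    parcels (probes u s) = (s.refs.erase u).val.map fun z => (z, .impl u) := by
  simp [parcels, probes, SafeMsg.parcels, Multiset.bind_map, Multiset.bind_singleton]

theorem parcels_requests : parcels (requests N hop u s) =
    (temporary N u s).val.map fun w => (hop u w, .req u w (s.var.1 w)) := by
  simp [parcels, requests, SafeMsg.parcels, Multiset.bind_map, Multiset.bind_singleton]

/-- Introduction changes only the list of what has been sent, so its side conditions stay valid
throughout. -/
theorem introductions {st : Finset V} {D : V → V → Prop} (c : SafeConf V)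
    (X : Multiset (V × Parcel V))
    (hX : ∀ p ∈ X, ∃ w, p.2 = .impl w ∧ c.Knows u p.1 ∧ c.Knows u w ∧ p.1 ≠ w) :
    ReflTransGen (ISFStep u st D) c { c with out := X + c.out } := by
  induction X using Multiset.induction_on with
  | empty => simpa using ReflTransGen.refl
  | cons p X ih =>
    refine (ih fun q hq => hX q (Multiset.mem_cons_of_mem hq)).tail ?_
    obtain ⟨w, h1, h2, h3, h4⟩ := hX p (Multiset.mem_cons_self _ _)
    have := ISFStep.introduction (u := u) (st := st) (D := D)
      { c with out := X + c.out } p.1 w p.2 h2 h3 h4 (.inr h1)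
    simpa using this

/-- A received reference is stored, delegated to the next hop, or fused with a known one. -/
theorem absorption (hr : IsRouting N hop D) {st E : Finset V} (hE : s.refs.erase u ⊆ E)
    (e : V → ℕ) (out : Multiset (V × Parcel V)) :
    ReflTransGen (ISFStep u st (D u)) ⟨E, {w}, e, out⟩
      ⟨E ∪ (absorb N u s w).erase u, 0, e, parcels (forward N hop u s w) + out⟩ := by
  rw [parcels_forward]
  refine ReflTransGen.single ?_
  by_cases hwu : w = u
  · have h1 : E ∪ (absorb N u s w).erase u = E := by
      rw [Finset.union_eq_left]
      refine subset_trans ?_ hE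
      unfold absorb
      split_ifs <;> simp [hwu]
    have := ISFStep.fusion (u := u) (st := st) (D := D u) ⟨E, {w}, e, out⟩ w (by simp) (.inl hwu)
    rw [h1]
    simpa [hwu] using this
  · by_cases hd : N u ⊆ s.refs
    · have h1 : E ∪ (absorb N u s w).erase u = E := by
        rw [Finset.union_eq_left]
        simpa [absorb, hd] using hE
      by_cases hN : w ∈ N u
      · have := ISFStep.store (u := u) (st := st) (D := D u) ⟨E, {w}, e, out⟩ w (by simp) hwu
        have h2 : w ∈ E := hE (by simp [hwu, hd hN])
        simpa [hN, h1, h2] using this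
      · have hm := hr.mem u w hwu hN
        have hm' : hop u w ≠ u := fun h => hr.irrefl u (by rwa [h] at hm)
        have hmw : hop u w ≠ w := fun h => hN (by rwa [h] at hm)
        have := ISFStep.implicitDelegation (u := u) (st := st) (D := D u) ⟨E, {w}, e, out⟩
          (hop u w) w (.impl w) (.inr (.inl (hE (by simp [hm', hd hm])))) (by simp) (Ne.symm hm')
          (Ne.symm hwu) hmw (.inr rfl) (hr.delegable u w hwu hN)
        simpa [hwu, hN, hd, h1] using this
    · have := ISFStep.store (u := u) (st := st) (D := D u) ⟨E, {w}, e, out⟩ w (by simp) hwu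
      have h1 : E ∪ (absorb N u s w).erase u = insert w E := by
        ext x
        simp only [absorb, hd, if_false, Finset.mem_union, Finset.mem_erase, Finset.mem_insert]
        constructor
        · rintro (h | ⟨h, rfl | h'⟩)
          exacts [.inr h, .inl rfl, .inr (hE (by simp [h, h']))]
        · rintro (rfl | h)
          exacts [.inr ⟨hwu, .inl rfl⟩, .inl h]
      simpa [h1, hd] using this

theorem delegationRequests (hr : IsRouting N hop D) (hd : N u ⊆ s.refs)
    (out : Multiset (V × Parcel V)) (W : Finset V) (hW : W ⊆ temporary N u s) :
    ReflTransGen (ISFStep u (stable N u s) (D u)) ⟨s.refs.erase u, 0, s.var.1, out⟩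
      ⟨s.refs.erase u, 0, raise hop u s W,
        W.val.map (fun w => (hop u w, .req u w (s.var.1 w))) + out⟩ := by
  -- Requests raise the sequence numbers of next hops only. These lie in `N u` and so are never
  -- temporary; hence each request carries the original number, whatever the order.
  have hnot : ∀ W : Finset V, W ⊆ temporary N u s → ∀ w ∈ temporary N u s,
      raise hop u s W w = s.var.1 w := by
    intro W hW w hw
    have : W.filter (fun x => hop u x = w) = ∅ := by
      rw [Finset.filter_eq_empty_iff]
      intro x hx hxw
      obtain ⟨-, h1, -, h2⟩ := mem_temporary.1 (hW hx)
      exact (mem_temporary.1 hw).2.2.2 (hxw ▸ hr.mem u x h1 h2)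
    simp [raise, this]
  induction W using Finset.induction_on with
  | empty =>
    have : raise hop u s ∅ = s.var.1 := by funext v; simp [raise]
    simpa [this] using ReflTransGen.refl
  | insert w W hwW ih =>
    have hw := hW (Finset.mem_insert_self w W)
    have hW' : W ⊆ temporary N u s := (Finset.subset_insert _ _).trans hW
    refine (ih hW').tail ?_
    obtain ⟨-, h1, h2, h3⟩ := mem_temporary.1 hw
    have hm := hr.mem u w h1 h3
    have hm' : hop u w ≠ u := fun h => hr.irrefl u (by rwa [h] at hm)
    have := ISFStep.request (u := u) (st := stable N u s) (D := D u)
      ⟨s.refs.erase u, 0, raise hop u s W,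
        W.val.map (fun w => (hop u w, .req u w (s.var.1 w))) + out⟩ (hop u w) w
      (by simp [hm', hd hm]) (by simp [stable, hd, hm, hd hm]) (by simp [h1, h2])
      (by simp [stable, hd, h3]) (hr.delegable u w h1 h3)
    convert this using 2
    · funext v
      simp only [hnot W hW' w hw]
      by_cases hv : v = hop u w
      · subst hv
        rw [Function.update_self]
        simp only [raise, Finset.filter_insert, if_true, Finset.sup_insert]
        rw [max_assoc, max_comm (Finset.sup _ _)]
      · rw [Function.update_of_ne hv]
        simp [raise, Finset.filter_insert, Ne.symm hv]
    · rw [Finset.insert_val_of_notMem hwW, Multiset.map_cons, Multiset.cons_add]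
      simp only [hnot W hW' w hw]

end Primitives

/-! ### Membership in the class built from `ISF`. -/

section Decomposition

variable {V : Type} [DecidableEq V] {N : V → Finset V} {hop : V → V → V} {D : V → V → V → Prop}
  {u w : V} {s : Memory V}

theorem yields_iff {t : Trigger Unit (Message V)} {o : Result V} :
    (safeProtocol N hop).toProtocol.Yields u t s o ↔ o = react N hop u s t := by
  unfold Protocol.Yields
  cases t <;> simp

theorem sentParcels_eq (o : Result V) : (safeProtocol N hop).sentParcels o = parcels o.sends := rfl

theorem ackValid_iff {n : ℕ} : (safeProtocol N hop).AckValid u s w n ↔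
    n = s.var.1 w ∧ w ∈ temporary N u s := by
  have : (safeProtocol N hop).Temporary u s w ↔ w ∈ temporary N u s := by
    unfold SafeProtocol.Temporary temporary
    rw [Finset.mem_sdiff, Finset.mem_erase, and_assoc]
  unfold SafeProtocol.AckValid
  rw [this]
  rfl

theorem sent_forward {hs : V → Prop} (hr : IsRouting N hop D) (h : ∀ v ∈ s.refs, hs v)
    {p : V × Message V} (hp : p ∈ forward N hop u s w) : hs p.1 := by
  obtain ⟨h1, h2, h3, rfl⟩ := mem_forward hp
  exact h _ (h1 (hr.mem u w h3 h2))

theorem decomposable_onImpl (hr : IsRouting N hop D) (st : Finset V) (probe : Bool) :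
    (∀ p ∈ (onImpl N hop u s w probe).sends,
      p.1 ∈ u ::ₘ ((s.refs.erase u).val + ({w} : Multiset V).filter (fun w => w ≠ u))) ∧
    ReflTransGen (ISFStep u st (D u)) ⟨s.refs.erase u, {w}, s.var.1, 0⟩
      ⟨(absorb N u s w).erase u, 0, s.var.1, parcels (onImpl N hop u s w probe).sends⟩ := by
  constructor
  · intro p hp
    rcases Multiset.mem_add.1 hp with hp | hp
    · refine sent_forward (hs := fun v => v ∈ u ::ₘ _) hr (fun v hv => ?_) hp
      by_cases hvu : v = u <;> simp [hvu, hv, -Finset.erase_val]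
    · cases probe
      · simp at hp
      · obtain ⟨z, -, rfl⟩ := Multiset.mem_map.1 hp
        by_cases hwu : w = u <;> simp [hwu, Multiset.filter_singleton]
  · have h1 : s.refs.erase u ∪ (absorb N u s w).erase u = (absorb N u s w).erase u := by
      rw [Finset.union_eq_right]
      exact Finset.erase_subset_erase _ fun v => mem_absorb_of_mem
    have h2 := absorption (w := w) hr (st := st) (subset_refl (s.refs.erase u)) s.var.1
      (parcels (if probe then reply u s w else 0))
    rw [h1, ← parcels_add] at h2
    -- The replies have to precede the absorption: they use the received reference of `w`, which may
    -- be delegated away by it.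
    refine ReflTransGen.trans ?_ h2
    cases probe
    · exact .refl
    · have := introductions (u := u) (st := st) (D := D u) ⟨s.refs.erase u, {w}, s.var.1, 0⟩
        (parcels (reply u s w)) ?_
      · simpa using this
      · intro p hp
        rw [parcels_reply] at hp
        obtain ⟨z, hz, rfl⟩ := Multiset.mem_map.1 hp
        rw [Finset.mem_val, Finset.mem_erase, Finset.mem_insert] at hz
        refine ⟨z, rfl, .inr (.inr (by simp)), ?_, hz.1.symm⟩
        by_cases hzu : z = u
        · exact .inl hzu
        · exact .inr (.inl (Finset.mem_erase.2 ⟨hzu, hz.2.resolve_left hzu⟩))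

theorem decomposable_onTimeout (hr : IsRouting N hop D) :
    (∀ p ∈ (onTimeout N hop u s).sends, p.1 ∈ u ::ₘ (s.refs.erase u).val) ∧
    ReflTransGen (ISFStep u (stable N u s) (D u)) ⟨s.refs.erase u, 0, s.var.1, 0⟩
      ⟨s.refs.erase u, 0, raise hop u s (temporary N u s),
        parcels (onTimeout N hop u s).sends⟩ := by
  constructor
  · intro p hp
    rcases Multiset.mem_add.1 hp with hp | hp
    · obtain ⟨w, hw, rfl⟩ := Multiset.mem_map.1 hp
      obtain ⟨h1, h2, -, h3⟩ := mem_temporary.1 hw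
      have := h1 (hr.mem u w h2 h3)
      by_cases hu : hop u w = u <;> simp [hu, this, -Finset.erase_val]
    · obtain ⟨z, hz, rfl⟩ := Multiset.mem_map.1 hp
      exact Multiset.mem_cons_of_mem hz
  · have h1 : ReflTransGen (ISFStep u (stable N u s) (D u)) ⟨s.refs.erase u, 0, s.var.1, 0⟩
        ⟨s.refs.erase u, 0, s.var.1, parcels (probes u s)⟩ := by
      have := introductions (u := u) (st := stable N u s) (D := D u)
        ⟨s.refs.erase u, 0, s.var.1, 0⟩ (parcels (probes u s)) ?_
      · simpa using this
      · intro p hp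
        rw [parcels_probes] at hp
        obtain ⟨z, hz, rfl⟩ := Multiset.mem_map.1 hp
        rw [Finset.mem_val] at hz
        exact ⟨u, rfl, .inr (.inl hz), .inl rfl, (Finset.mem_erase.1 hz).1⟩
    refine h1.trans ?_
    simp only [onTimeout, parcels_add, parcels_requests]
    by_cases hd : N u ⊆ s.refs
    · exact delegationRequests hr hd _ _ subset_rfl
    · have h2 : temporary N u s = ∅ := by
        ext w
        simp [mem_temporary, hd]
      have h3 : raise hop u s ∅ = s.var.1 := by funext v; simp [raise]
      rw [h2, h3]
      simpa using ReflTransGen.refl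

theorem decomposable (hr : IsRouting N hop D) (u : V) (t : Trigger Unit (Message V))
    (s : Memory V) (o : Result V) (h : (safeProtocol N hop).toProtocol.Yields u t s o) :
    (safeProtocol N hop).ISFDecomposable (D u) u t s o := by
  obtain rfl := yields_iff.1 h
  match t with
  | .guarded _ =>
    obtain ⟨h1, h2⟩ := decomposable_onTimeout (u := u) (s := s) hr
    refine ⟨fun p hp => ?_, _, rfl, h2⟩
    simpa [Protocol.held, Protocol.triggerRefs] using h1 p hp
  | .message (.other p) => exact p.elim
  | .message (.impl w k) =>
    obtain ⟨h1, h2⟩ := decomposable_onImpl (u := u) (s := s) (w := w) hr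
      (stable N u (onImpl N hop u s w k).next) k
    exact ⟨h1, _, rfl, h2⟩
  | .message (.ack w n k) =>
    by_cases hv : n = s.var.1 w ∧ w ∈ temporary N u s
    · obtain ⟨h1, h2, h3, h4⟩ := mem_temporary.1 hv.2
      have hm := hr.mem u w h2 h4
      have hm' : hop u w ≠ u := fun h => hr.irrefl u (by rwa [h] at hm)
      have hmw : hop u w ≠ w := fun h => h4 (by rwa [h] at hm)
      have hre : react N hop u s (.message (.ack w n k)) =
          ⟨⟨s.refs.erase w, s.var⟩, {(hop u w, .impl w false)}⟩ := by
        simp [react, onAck, hv, forward, h1, h2, h4]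
      rw [hre]
      refine ⟨fun p hp => ?_, ⟨(s.refs.erase w).erase u, 0, s.var.1, {(hop u w, .impl w)}⟩,
        .inl ⟨ackValid_iff.2 hv, hop u w, h1 hm, hm', hmw, hr.delegable u w h2 h4, rfl⟩, ?_⟩
      · rw [Multiset.mem_singleton.1 hp]
        exact Protocol.mem_held_of_mem_refs (h1 hm)
      -- The prescribed reaction already removes the edge and sends ImplDelegate, so no primitive is
      -- left to apply.
      · have : parcels {(hop u w, .impl w false)} = {(hop u w, .impl w)} := by
          simp [parcels, SafeMsg.parcels]
        rw [sentParcels_eq, this]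
        exact .refl
    · have hre : react N hop u s (.message (.ack w n k)) = onImpl N hop u s w false := by
        simp [react, onAck, hv]
      obtain ⟨h1, h2⟩ := decomposable_onImpl (u := u) (s := s) (w := w) hr
        (stable N u (onImpl N hop u s w false).next) false
      rw [hre]
      exact ⟨h1, _, .inr ⟨fun h => hv (ackValid_iff.1 h), rfl⟩, h2⟩
  | .message (.req x w n k) =>
    -- The reference of the requesting node `x` is not discarded after the acknowledgement but
    -- absorbed like any other received one.
    refine ⟨fun p hp => ?_, _, ⟨{x}, .inl rfl, rfl⟩, ?_⟩
    · rcases Multiset.mem_add.1 hp with hp | hp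
      · exact sent_forward (hs := fun v => v ∈ Protocol.held _ _ _ _) hr (fun v hv => Protocol.mem_held_of_mem_refs hv) hp
      · rw [Multiset.mem_singleton.1 hp]
        by_cases hx : x = u <;>
          simp [Protocol.held, Protocol.triggerRefs, SafeMsg.refsOf, hx]
    · have h1 := absorption (u := u) (w := x) (s := s) hr
        (st := stable N u (onReq N hop u s x w n).next)
        (Finset.erase_subset_erase u (Finset.subset_insert w s.refs))
        (Function.update s.var.1 w (max (s.var.1 w) (n + 1))) {(x, .ack w n)}
      have h2 : (insert w s.refs).erase u ∪ (absorb N u s x).erase u =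
          (insert w (absorb N u s x)).erase u := by
        ext v
        simp only [Finset.mem_union, Finset.mem_erase, Finset.mem_insert]
        have := mem_absorb_of_mem (N := N) (u := u) (s := s) (w := x) (v := v)
        tauto
      have h3 : parcels (onReq N hop u s x w n).sends =
          parcels (forward N hop u s x) + {(x, .ack w n)} := by
        simp [onReq, parcels_add]
        simp [parcels, SafeMsg.parcels]
      rw [h2, ← h3] at h1
      exact h1

theorem inPISF (hr : IsRouting N hop D) : (safeProtocol N hop).InPISF := by
  refine ⟨fun u => decomposable (D := fun _ _ _ => True)
    ⟨hr.irrefl, hr.mem, fun _ _ _ _ => trivial⟩ u, fun u s w n k h => ⟨false, fun o ho => ?_⟩⟩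
  have h' := mt ackValid_iff.2 h
  refine yields_iff.2 ((yields_iff.1 ho).trans ?_)
  simp [react, onAck, h']

end Decomposition

/-! ### What a single reaction keeps, sends and changes. -/

section Reactions

variable {V : Type} [DecidableEq V] {N : V → Finset V} {hop : V → V → V} {D : V → V → V → Prop}
  {u w : V} {s : Memory V} {t : Trigger Unit (Message V)}

/-- The network protocol. -/
abbrev network (N : V → Finset V) (hop : V → V → V) : Protocol V := (safeProtocol N hop).toProtocol

/-- Every reference is kept or sent on to the next hop. -/
theorem kept_or_forwarded {b : V} (hb : b ≠ u)
    (h : b ∈ s.refs ∨ b ∈ (network N hop).triggerRefs t) :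
    b ∈ (react N hop u s t).next.refs ∨ N u ⊆ s.refs ∧ b ∉ N u ∧
      (hop u b, .impl b false) ∈ (react N hop u s t).sends := by
  have himpl : ∀ w k, b ∈ s.refs ∨ b = w → b ∈ (onImpl N hop u s w k).next.refs ∨
      N u ⊆ s.refs ∧ b ∉ N u ∧ (hop u b, .impl b false) ∈ (onImpl N hop u s w k).sends := by
    rintro w k (h | rfl)
    · exact .inl (mem_absorb_of_mem h)
    · rcases mem_absorb_or (N := N) (hop := hop) (s := s) hb with h | ⟨h1, h2, h3⟩
      · exact .inl h
      · exact .inr ⟨h1, h2, by simp [onImpl, h3]⟩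
  match t with
  | .guarded _ => exact .inl (by simpa [react, onTimeout, Protocol.triggerRefs] using h)
  | .message (.other p) => exact p.elim
  | .message (.impl w k) =>
    exact himpl w k (by simpa [Protocol.triggerRefs, SafeMsg.refsOf] using h)
  | .message (.ack w n k) =>
    have h' : b ∈ s.refs ∨ b = w := by simpa [Protocol.triggerRefs, SafeMsg.refsOf] using h
    by_cases hv : n = s.var.1 w ∧ w ∈ temporary N u s
    · obtain ⟨h1, h2, h3, h4⟩ := mem_temporary.1 hv.2
      simp only [react, onAck, hv, and_self, if_true]
      by_cases hbw : b = w
      · subst hbw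
        exact .inr ⟨h1, h4, by simp [forward, h1, h2, h4]⟩
      · exact .inl (Finset.mem_erase.2 ⟨hbw, h'.resolve_right hbw⟩)
    · simpa only [react, onAck, hv, if_false] using himpl w false h'
  | .message (.req x w n k) =>
    have h' : b ∈ s.refs ∨ b = x ∨ b = w := by
      simpa [Protocol.triggerRefs, SafeMsg.refsOf] using h
    rcases h' with h | rfl | rfl
    · exact .inl (Finset.mem_insert_of_mem (mem_absorb_of_mem h))
    · rcases mem_absorb_or (N := N) (hop := hop) (s := s) hb with h | ⟨h1, h2, h3⟩
      · exact .inl (Finset.mem_insert_of_mem h)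
      · exact .inr ⟨h1, h2, by simp [react, onReq, h3]⟩
    · exact .inl (Finset.mem_insert_self _ _)

theorem eq_impl_of_mem_forward {v : V} {m : Message V} (h : (v, m) ∈ forward N hop u s w) :
    m = .impl w false := congrArg Prod.snd (mem_forward h).2.2.2

theorem sends_onImpl {v : V} {m : Message V} {k : Bool}
    (h : (v, m) ∈ (onImpl N hop u s w k).sends) : ∃ z, m = .impl z false := by
  rcases Multiset.mem_add.1 h with h | h
  · exact ⟨_, eq_impl_of_mem_forward h⟩
  · cases k
    · simp at h
    · obtain ⟨z, -, h⟩ := Multiset.mem_map.1 h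
      exact ⟨z, (congrArg Prod.snd h).symm⟩

theorem sends_onAck {v : V} {m : Message V} {n : ℕ}
    (h : (v, m) ∈ (onAck N hop u s w n).sends) : ∃ z, m = .impl z false := by
  unfold onAck at h
  split_ifs at h
  · exact ⟨_, eq_impl_of_mem_forward h⟩
  · exact sends_onImpl h

theorem req_sent {v x : V} {n : ℕ} {k : Bool}
    (h : (v, .req x w n k) ∈ (react N hop u s t).sends) :
    w ∈ temporary N u s ∧ v = hop u w := by
  match t with
  | .guarded _ =>
    rcases Multiset.mem_add.1 h with h | h
    · obtain ⟨z, hz, h⟩ := Multiset.mem_map.1 h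
      simp only [Prod.mk.injEq, SafeMsg.req.injEq] at h
      obtain ⟨rfl, rfl, rfl, rfl, -⟩ := h
      exact ⟨hz, rfl⟩
    · obtain ⟨z, hz, h⟩ := Multiset.mem_map.1 h
      simp at h
  | .message (.other p) => exact p.elim
  | .message (.impl w k) => obtain ⟨z, h⟩ := sends_onImpl h; simp at h
  | .message (.ack w n k) => obtain ⟨z, h⟩ := sends_onAck h; simp at h
  | .message (.req x w n k) =>
    rcases Multiset.mem_add.1 h with h | h
    · exact absurd (eq_impl_of_mem_forward h) (by simp)
    · simp at h

theorem ack_sent {v : V} {n : ℕ} {k : Bool}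
    (h : (v, .ack w n k) ∈ (react N hop u s t).sends) :
    ∃ k', t = .message (.req v w n k') := by
  match t with
  | .guarded _ =>
    rcases Multiset.mem_add.1 h with h | h <;>
    · obtain ⟨z, hz, h⟩ := Multiset.mem_map.1 h
      simp at h
  | .message (.other p) => exact p.elim
  | .message (.impl w k) => obtain ⟨z, h⟩ := sends_onImpl h; simp at h
  | .message (.ack w n k) => obtain ⟨z, h⟩ := sends_onAck h; simp at h
  | .message (.req x w n k) =>
    rcases Multiset.mem_add.1 h with h | h
    · exact absurd (eq_impl_of_mem_forward h) (by simp)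
    · simp only [Multiset.mem_singleton, Prod.mk.injEq, SafeMsg.ack.injEq] at h
      obtain ⟨rfl, rfl, rfl, -⟩ := h
      exact ⟨_, rfl⟩

/-- A node that knows all its target neighbours stores further references only on request. -/
theorem stored_on_request (hd : N u ⊆ s.refs) (h : w ∈ (react N hop u s t).next.refs) :
    w ∈ s.refs ∨ ∃ x n k, t = .message (.req x w n k) := by
  match t with
  | .guarded _ => exact .inl h
  | .message (.other p) => exact p.elim
  | .message (.impl x k) => exact .inl (by simpa [react, onImpl, absorb, hd] using h)
  | .message (.ack x n k) =>
    left
    simp only [react, onAck] at h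
    split_ifs at h
    · exact Finset.mem_of_mem_erase h
    · simpa [onImpl, absorb, hd] using h
  | .message (.req x y n k) =>
    simp only [react, onReq, absorb, hd, if_true, Finset.mem_insert] at h
    rcases h with rfl | h
    exacts [.inr ⟨_, _, _, rfl⟩, .inl h]

/-- The sequence number of a temporary edge changes only on request. -/
theorem eseq_eq (hr : IsRouting N hop D) (hw : w ∉ N u)
    (ht : ∀ x n k, t ≠ .message (.req x w n k)) :
    (react N hop u s t).next.var.1 w = s.var.1 w := by
  match t with
  | .guarded _ =>
    have : (temporary N u s).filter (fun x => hop u x = w) = ∅ := by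
      rw [Finset.filter_eq_empty_iff]
      intro x hx hxw
      obtain ⟨-, h1, -, h2⟩ := mem_temporary.1 hx
      exact hw (hxw ▸ hr.mem u x h1 h2)
    simp [react, onTimeout, raise, this]
  | .message (.other p) => exact p.elim
  | .message (.impl x k) => rfl
  | .message (.ack x n k) =>
    simp only [react, onAck]
    split_ifs <;> rfl
  | .message (.req x y n k) =>
    have : w ≠ y := by rintro rfl; exact ht _ _ _ rfl
    simp [react, onReq, this]

theorem removed_by_ack {k : Bool} (h : w ∈ temporary N u s) :
    w ∉ (react N hop u s (.message (.ack w (s.var.1 w) k))).next.refs := by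
  simp [react, onAck, h]

theorem request_mem_sends (h : w ∈ temporary N u s) :
    (hop u w, .req u w (s.var.1 w) false) ∈ (react N hop u s (.guarded ())).sends :=
  Multiset.mem_add.2 (.inl (Multiset.mem_map.2 ⟨w, h, rfl⟩))

theorem probe_mem_sends (hw : w ∈ s.refs) (hwu : w ≠ u) :
    (w, .impl u true) ∈ (react N hop u s (.guarded ())).sends :=
  Multiset.mem_add.2 (.inr (Multiset.mem_map.2 ⟨w, by simp [hw, hwu, -Finset.erase_val], rfl⟩))

theorem reply_mem_sends {z : V} (hz : z ∈ s.refs ∨ z = u) (hzw : z ≠ w) :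
    (w, .impl z false) ∈ (react N hop u s (.message (.impl w true))).sends :=
  Multiset.mem_add.2 (.inr (by
    rw [if_pos rfl]
    refine Multiset.mem_map.2 ⟨z, ?_, rfl⟩
    rw [Finset.mem_val, Finset.mem_erase, Finset.mem_insert]
    exact ⟨hzw, hz.symm⟩))

end Reactions

/-! ### Effect of a step on memories and channels. -/

section Steps

variable {V : Type} [DecidableEq V] {N : V → Finset V} {hop : V → V → V}
  {u : V} {t : Trigger Unit (Message V)} {S S' : (network N hop).State}

theorem step_loc (h : (network N hop).StepBy u t S S') :
    S'.loc u = (react N hop u (S.loc u) t).next := by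
  obtain ⟨o, rest, hy, -, hl, -⟩ := h
  rw [hl, Function.update_self, yields_iff.1 hy]

theorem step_loc_of_ne (h : (network N hop).StepBy u t S S') {v : V} (hv : v ≠ u) :
    S'.loc v = S.loc v := by
  obtain ⟨o, rest, -, -, hl, -⟩ := h
  rw [hl, Function.update_of_ne hv]

theorem step_ch (h : (network N hop).StepBy u t S S') (v : V) :
    ∃ rest o, S.ch v = (if u = v then (network N hop).consumed t else 0) + rest ∧
      S'.ch v = rest + o ∧ ∀ m, m ∈ o ↔ (v, m) ∈ (react N hop u (S.loc u) t).sends := by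
  obtain ⟨o, rest, hy, hch, -, hch'⟩ := h
  have hs : ∀ m, m ∈ (network N hop).sentTo o v ↔
      (v, m) ∈ (react N hop u (S.loc u) t).sends := by
    intro m
    rw [← yields_iff.1 hy]
    simp [Protocol.sentTo]
  by_cases huv : u = v
  · subst huv
    exact ⟨rest, _, by simp [hch], by simp [hch'], hs⟩
  · exact ⟨S.ch v, _, by simp [huv], by simp [hch', Ne.symm huv], hs⟩

theorem step_mem_ch (h : (network N hop).StepBy u t S S') {v : V} {m : Message V}
    (hm : m ∈ S'.ch v) : m ∈ S.ch v ∨ (v, m) ∈ (react N hop u (S.loc u) t).sends := by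
  obtain ⟨rest, o, h1, h2, h3⟩ := step_ch h v
  rw [h2, Multiset.mem_add] at hm
  rw [h1, Multiset.mem_add, ← h3]
  tauto

theorem step_mem_ch_of_sends (h : (network N hop).StepBy u t S S') {v : V} {m : Message V}
    (hm : (v, m) ∈ (react N hop u (S.loc u) t).sends) : m ∈ S'.ch v := by
  obtain ⟨rest, o, h1, h2, h3⟩ := step_ch h v
  rw [h2, Multiset.mem_add, h3]
  exact .inr hm

theorem step_message_mem {m : Message V} (h : (network N hop).StepBy u (.message m) S S') :
    m ∈ S.ch u := by
  obtain ⟨rest, o, h1, h2, h3⟩ := step_ch h u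
  simp [h1, Protocol.consumed]

/-- `a` stores the reference of `b` or has it in its channel. -/
def Aware (S : (network N hop).State) (a b : V) : Prop :=
  b ∈ (S.loc a).refs ∨ ∃ m ∈ S.ch a, b ∈ (network N hop).refsOf m

theorem step_refs_subset (h : (network N hop).StepBy u t S S') {a b : V} (hab : b ≠ a)
    (hb : b ∈ (S.loc a).refs) : b ∈ (S'.loc a).refs ∨
      N a ⊆ (S.loc a).refs ∧ b ∉ N a ∧ SafeMsg.impl b false ∈ S'.ch (hop a b) := by
  by_cases hau : a = u
  · subst hau
    rcases kept_or_forwarded (N := N) (hop := hop) (t := t) hab (.inl hb) with h2 | ⟨h2, h3, h4⟩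
    · exact .inl (by rw [step_loc h]; exact h2)
    · exact .inr ⟨h2, h3, step_mem_ch_of_sends h h4⟩
  · exact .inl (by rw [step_loc_of_ne h hau]; exact hb)

theorem step_message_refs {m : Message V} (h : (network N hop).StepBy u (.message m) S S') {b : V}
    (hbu : b ≠ u) (hb : b ∈ (network N hop).refsOf m) : b ∈ (S'.loc u).refs ∨
      N u ⊆ (S.loc u).refs ∧ b ∉ N u ∧ SafeMsg.impl b false ∈ S'.ch (hop u b) := by
  rcases kept_or_forwarded (N := N) (hop := hop) (s := S.loc u) (t := .message m) hbu (.inr hb)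
    with h2 | ⟨h2, h3, h4⟩
  · exact .inl (by rw [step_loc h]; exact h2)
  · exact .inr ⟨h2, h3, step_mem_ch_of_sends h h4⟩

/-- Only references outside `N a` are ever given up, so completeness of a node is irreversible. -/
theorem step_target_subset (hN : ∀ u, u ∉ N u) (h : (network N hop).StepBy u t S S') {a : V}
    (ha : N a ⊆ (S.loc a).refs) : N a ⊆ (S'.loc a).refs := by
  intro b hb
  rcases step_refs_subset h (by rintro rfl; exact hN _ hb) (ha hb) with h1 | h1
  exacts [h1, absurd hb h1.2.1]

end Steps

/-! ### Delegations come to an end. -/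

section Termination

open Filter

variable {V : Type} [DecidableEq V] {N : V → Finset V} {hop : V → V → V} {D : V → V → V → Prop}
  (C : (network N hop).Computation)

theorem eventually_drained (v : V) (p : Message V → Prop)
    (h : ∀ᶠ i in atTop, ∀ m, (v, m) ∈ (react N hop (C.node i) ((C.state i).loc (C.node i))
      (C.trig i)).sends → ¬ p m) :
    ∀ᶠ i in atTop, ∀ m ∈ (C.state i).ch v, ¬ p m := by
  obtain ⟨n, hn⟩ := eventually_atTop.1 h
  refine eventually_atTop.2 (C.eventually_drained v p ⟨n, fun i hi => ?_⟩)
  obtain ⟨rest, o, h1, h2, h3⟩ := step_ch (C.step i) v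
  exact ⟨rest, o, h1, h2, fun m hm => hn i hi m ((h3 m).1 hm)⟩

theorem target_subset_mono (hN : ∀ u, u ∉ N u) {a : V} {i j : ℕ} (hij : i ≤ j)
    (h : N a ⊆ ((C.state i).loc a).refs) : N a ⊆ ((C.state j).loc a).refs := by
  induction j, hij using Nat.le_induction with
  | base => exact h
  | succ j _ ih => exact step_target_subset hN (C.step j) ih

theorem timeout_executed (u : V) (n : ℕ) :
    ∃ j, n ≤ j ∧ C.node j = u ∧ C.trig j = .guarded () :=
  C.weakly_fair u () ⟨0, fun _ _ => trivial⟩ n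

/-- A temporary edge is removed if nobody requests to store it again. -/
theorem eventually_removed (hr : IsRouting N hop D) (u w : V)
    (h : ∀ᶠ i in atTop, ∀ x n k, SafeMsg.req x w n k ∉ (C.state i).ch u) :
    ∀ᶠ i in atTop, w ∉ temporary N u ((C.state i).loc u) := by
  by_cases hd : ∃ i, N u ⊆ ((C.state i).loc u).refs
  swap
  · push Not at hd
    exact .of_forall fun i hi => hd i (mem_temporary.1 hi).1
  obtain ⟨i₀, hi₀⟩ := hd
  obtain ⟨i₁, hi₁⟩ := eventually_atTop.1 h
  have hdone : ∀ i, max i₀ i₁ ≤ i → N u ⊆ ((C.state i).loc u).refs := fun i hi =>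
    target_subset_mono C hr.irrefl (by omega) hi₀
  -- Without requests to store `w`, a complete node cannot acquire this edge anew; one moment of
  -- absence is therefore enough.
  have hback : ∀ i, max i₀ i₁ ≤ i → w ∈ temporary N u ((C.state (i + 1)).loc u) →
      w ∈ temporary N u ((C.state i).loc u) := by
    intro i hi hw
    obtain ⟨-, h1, h2, h3⟩ := mem_temporary.1 hw
    refine mem_temporary.2 ⟨hdone i hi, h1, ?_, h3⟩
    have hs := C.step i
    by_cases hu : u = C.node i
    · rw [← hu] at hs
      rw [step_loc hs] at h2
      rcases stored_on_request (hdone i hi) h2 with h4 | ⟨x, n, k, h4⟩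
      · exact h4
      · rw [h4] at hs
        exact absurd (step_message_mem hs) (hi₁ i (by omega) x n k)
    · rwa [step_loc_of_ne hs hu] at h2
  by_cases hex : ∃ i, max i₀ i₁ ≤ i ∧ w ∉ temporary N u ((C.state i).loc u)
  · obtain ⟨i, hi, hw⟩ := hex
    refine eventually_atTop.2 ⟨i, fun j hj => ?_⟩
    induction j, hj using Nat.le_induction with
    | base => exact hw
    | succ j hj ih => exact fun h' => ih (hback j (by omega) h')
  push Not at hex
  exfalso
  have hnot : w ∉ N u := (mem_temporary.1 (hex _ le_rfl)).2.2.2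
  -- If the edge stayed forever, its sequence number would be frozen. The acknowledgement of a
  -- request sent now would then still be valid on arrival and remove the edge.
  have heseq : ∀ i, max i₀ i₁ ≤ i →
      ((C.state i).loc u).var.1 w = ((C.state (max i₀ i₁)).loc u).var.1 w := by
    intro i hi
    induction i, hi using Nat.le_induction with
    | base => rfl
    | succ i hi ih =>
      rw [← ih]
      have hs := C.step i
      by_cases hu : u = C.node i
      · rw [← hu] at hs
        rw [step_loc hs]
        refine eseq_eq hr hnot fun x n k h4 => ?_
        rw [h4] at hs
        exact hi₁ i (by omega) x n k (step_message_mem hs)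
      · rw [step_loc_of_ne hs hu]
  obtain ⟨j, hj, hju, hjt⟩ := timeout_executed C u (max i₀ i₁)
  have hs := C.step j
  rw [hju, hjt] at hs
  have hreq := step_mem_ch_of_sends hs (request_mem_sends (hex j hj))
  obtain ⟨j', hj', hju, hjt⟩ := C.fair_receipt (j + 1) _ _ hreq
  have hs := C.step j'
  rw [hju, hjt] at hs
  have hack : SafeMsg.ack w (((C.state j).loc u).var.1 w) false ∈ (C.state (j' + 1)).ch u :=
    step_mem_ch_of_sends hs (Multiset.mem_add.2 (.inr (Multiset.mem_singleton_self _)))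
  obtain ⟨l, hl, hlu, hlt⟩ := C.fair_receipt (j' + 1) _ _ hack
  have hs := C.step l
  rw [hlu, hlt, (heseq j hj).trans (heseq l (by omega)).symm] at hs
  have hrem := removed_by_ack (N := N) (hop := hop) (k := false) (hex l (by omega))
  rw [← step_loc hs] at hrem
  exact hrem (mem_temporary.1 (hex (l + 1) (by omega))).2.2.1

variable [Finite V] {δ : V → V → ℝ}

/-- A request to store `w` that reaches `u` comes from a node farther from `w` with a temporary edge
to `w`. Inductively such nodes eventually receive no requests for `w`, so by `eventually_removed`
they lose that edge; the source dries up and the channel of `u` drains. -/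
theorem eventually_no_request (hr : IsRouting N hop D)
    (hδ : ∀ u w, w ≠ u → w ∉ N u → δ (hop u w) w < δ u w) (w u : V) :
    ∀ᶠ i in atTop, ∀ x n k, SafeMsg.req x w n k ∉ (C.state i).ch u := by
  -- Farther nodes come first; finiteness of `V` makes this order well-founded although `δ` is
  -- real-valued.
  let r : V → V → Prop := fun x u => δ u w < δ x w
  have : IsTrans V r := ⟨fun _ _ _ h h' => lt_trans (b := δ _ w) h' h⟩
  have : Std.Irrefl r := ⟨fun _ => lt_irrefl (δ _ w)⟩
  induction u using (Finite.wellFounded_of_trans_of_irrefl r).induction with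
  | _ u ih =>
  have hsrc : ∀ᶠ i in atTop, ∀ x, r x u → w ∉ temporary N x ((C.state i).loc x) :=
    eventually_all.2 fun x => eventually_imp_distrib_left.2 fun hx =>
      eventually_removed C hr x w (ih x hx)
  have := eventually_drained C u (fun m => ∃ x n k, m = .req x w n k) <|
    hsrc.mono fun i hi m hm => by
      rintro ⟨x, n, k, rfl⟩
      obtain ⟨h1, h2⟩ := req_sent hm
      obtain ⟨-, h3, -, h4⟩ := mem_temporary.1 h1
      exact hi _ (by subst h2; exact hδ _ _ h3 h4) h1
  exact this.mono fun i hi x n k hm => hi _ hm ⟨x, n, k, rfl⟩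

/-- No message of Safe-Delegation and no temporary edge is left. -/
structure Quiet (S : (network N hop).State) : Prop where
  no_req : ∀ v x w n k, SafeMsg.req x w n k ∉ S.ch v
  no_ack : ∀ v w n k, SafeMsg.ack w n k ∉ S.ch v
  no_temporary : ∀ u w, w ∉ temporary N u (S.loc u)

/-- Every computation comes to an end with its delegations. -/
theorem eventually_quiet (hr : IsRouting N hop D)
    (hδ : ∀ u w, w ≠ u → w ∉ N u → δ (hop u w) w < δ u w) :
    ∀ᶠ i in atTop, Quiet (C.state i) := by
  have h1 : ∀ᶠ i in atTop, ∀ w v, ∀ x n k, SafeMsg.req x w n k ∉ (C.state i).ch v :=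
    eventually_all.2 fun w => eventually_all.2 fun v => eventually_no_request C hr hδ w v
  have h2 : ∀ᶠ i in atTop, ∀ u w, w ∉ temporary N u ((C.state i).loc u) :=
    eventually_all.2 fun u => eventually_all.2 fun w =>
      eventually_removed C hr u w (eventually_no_request C hr hδ w u)
  have h3 : ∀ᶠ i in atTop, ∀ v, ∀ m ∈ (C.state i).ch v, ¬ ∃ w n k, m = SafeMsg.ack w n k := by
    refine eventually_all.2 fun v => eventually_drained C v _ (h1.mono fun i hi m hm => ?_)
    rintro ⟨w, n, k, rfl⟩
    obtain ⟨k', ht⟩ := ack_sent hm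
    have hs := C.step i
    rw [ht] at hs
    exact hi _ _ _ _ _ (step_message_mem hs)
  filter_upwards [h1, h2, h3] with i hi1 hi2 hi3
  exact ⟨fun v x w n k => hi1 w v x n k, fun v w n k hm => hi3 v _ hm ⟨w, n, k, rfl⟩, hi2⟩

end Termination

/-! ### Every node completes its target neighbourhood. -/

section Convergence

open Filter

variable {V : Type} [DecidableEq V] {N : V → Finset V} {hop : V → V → V} {D : V → V → V → Prop}
  (C : (network N hop).Computation)

/-- After step `i` the next hop of `a` has the reference of `b` in its channel. -/
def Forwarded (i : ℕ) (a b : V) : Prop :=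
  N a ⊆ ((C.state i).loc a).refs ∧ b ∉ N a ∧ SafeMsg.impl b false ∈ (C.state (i + 1)).ch (hop a b)

theorem refs_or_forwarded {a b : V} (hab : b ≠ a) {i j : ℕ} (hij : i ≤ j)
    (h : b ∈ ((C.state i).loc a).refs) :
    b ∈ ((C.state j).loc a).refs ∨ ∃ l, Forwarded C l a b := by
  induction j, hij using Nat.le_induction with
  | base => exact .inl h
  | succ j _ ih =>
    rcases ih with ih | ih
    · exact (step_refs_subset (C.step j) hab ih).imp_right fun h => ⟨j, h⟩
    · exact .inr ih

theorem aware_or_forwarded {a b : V} (hab : b ≠ a) {i : ℕ} (h : Aware (C.state i) a b) :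
    (∃ j, b ∈ ((C.state j).loc a).refs) ∨ ∃ l, Forwarded C l a b := by
  rcases h with h | ⟨m, hm, hb⟩
  · exact .inl ⟨i, h⟩
  · obtain ⟨j, -, hju, hjt⟩ := C.fair_receipt i a m hm
    have hs := C.step j
    rw [hju, hjt] at hs
    exact (step_message_refs hs hab hb).imp (fun h => ⟨_, h⟩) fun h => ⟨j, h⟩

theorem aware_of_probe {a b : V} (hab : b ≠ a) {j : ℕ} (hju : C.node j = a)
    (hjt : C.trig j = .guarded ()) (hb : b ∈ ((C.state j).loc a).refs) :
    SafeMsg.impl a true ∈ (C.state (j + 1)).ch b := by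
  have hs := C.step j
  rw [hju, hjt] at hs
  exact step_mem_ch_of_sends hs (probe_mem_sends hb hab)

theorem aware_impl {S : (network N hop).State} {a b : V} {k : Bool}
    (h : SafeMsg.impl b k ∈ S.ch a) : Aware S a b :=
  .inr ⟨_, h, by simp [SafeMsg.refsOf]⟩

theorem eventually_refs_of_target_subset (hN : ∀ u, u ∉ N u) {a b : V} {i : ℕ}
    (h : N a ⊆ ((C.state i).loc a).refs) (hb : b ∈ N a) :
    ∀ᶠ j in atTop, b ∈ ((C.state j).loc a).refs :=
  eventually_atTop.2 ⟨i, fun _ hj => target_subset_mono C hN hj h hb⟩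

variable {x : V} (hx : ∀ i, ¬ N x ⊆ ((C.state i).loc x).refs)

/-- The references that a node obtains in the course of the computation, and its own one. -/
def Learns (x b : V) : Prop := b = x ∨ ∃ i, b ∈ ((C.state i).loc x).refs

include hx

/-- The node `x` is incomplete at all times, so it never forwards a reference and must store
whatever arrives in its channel. -/
theorem Learns.of_aware {b : V} {i : ℕ} (h : Aware (C.state i) x b) : Learns C x b := by
  by_cases hb : b = x
  · exact .inl hb
  · rcases aware_or_forwarded C hb h with h | ⟨l, h⟩
    exacts [.inr h, absurd h.1 (hx l)]

theorem Learns.eventually {b : V} (hb : b ≠ x) (h : Learns C x b) :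
    ∀ᶠ i in atTop, b ∈ ((C.state i).loc x).refs := by
  obtain ⟨i, hi⟩ := h.resolve_left hb
  refine eventually_atTop.2 ⟨i, fun j hj => ?_⟩
  rcases refs_or_forwarded C hb hj hi with h | ⟨l, h⟩
  exacts [h, absurd h.1 (hx l)]

theorem Learns.exists_probe {a : V} (ha : a ≠ x) (h : Learns C x a) (n : ℕ) :
    ∃ j, n ≤ j ∧ C.node j = a ∧ C.trig j = .message (.impl x true) := by
  obtain ⟨i, hi⟩ := eventually_atTop.1 (Learns.eventually C hx ha h)
  obtain ⟨j, hj, hju, hjt⟩ := timeout_executed C x (max i n)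
  obtain ⟨l, hl, hlu, hlt⟩ := C.fair_receipt _ _ _
    (aware_of_probe C ha hju hjt (hi j (by omega)))
  exact ⟨l, by omega, hlu, hlt⟩

theorem Learns.of_reply {a b : V} {j : ℕ} (hju : C.node j = a)
    (hjt : C.trig j = .message (.impl x true)) (hb : b ∈ ((C.state j).loc a).refs) :
    Learns C x b := by
  by_cases hbx : b = x
  · exact .inl hbx
  · have hs := C.step j
    rw [hju, hjt] at hs
    exact Learns.of_aware C hx (aware_impl (step_mem_ch_of_sends hs
      (reply_mem_sends (.inl hb) hbx)))

/-- The node `x` probes `a` again and again, and late replies include everything that `a` holds from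
some time on. -/
theorem Learns.of_eventually {a b : V} (h : Learns C x a)
    (hb : ∀ᶠ i in atTop, b ∈ ((C.state i).loc a).refs) : Learns C x b := by
  obtain ⟨i, hi⟩ := eventually_atTop.1 hb
  by_cases ha : a = x
  · exact .inr ⟨i, ha ▸ hi i le_rfl⟩
  · obtain ⟨j, hj, hju, hjt⟩ := Learns.exists_probe C hx ha h i
    exact Learns.of_reply C hx hju hjt (hi j hj)

variable [Finite V] {δ : V → V → ℝ} (hr : IsRouting N hop D)
  (hδ : ∀ u w, w ≠ u → w ∉ N u → δ (hop u w) w < δ u w)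

include hr hδ

/-- Either `a` still stores `b` when a probe of `x` arrives, and reports it, or `a` has passed `b`
to its next hop. That hop is a target neighbour which `a` holds forever, so `x` learns it and
continues the pursuit there, closer to `b`. -/
theorem Learns.trans_aware {a b : V} {i : ℕ} (ha : Learns C x a) (h : Aware (C.state i) a b) :
    Learns C x b := by
  let r : V → V → Prop := fun a' a => δ a' b < δ a b
  have : IsTrans V r := ⟨fun _ _ _ h h' => lt_trans (b := δ _ b) h h'⟩
  have : Std.Irrefl r := ⟨fun _ => lt_irrefl (δ _ b)⟩
  induction a using (Finite.wellFounded_of_trans_of_irrefl r).induction generalizing i with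
  | _ a ih =>
  by_cases hab : b = a
  · rwa [hab]
  by_cases hax : a = x
  · subst hax
    exact Learns.of_aware C hx h
  have hfwd : ∀ l, Forwarded C l a b → Learns C x b := fun l hl =>
    ih (hop a b) (hδ a b hab hl.2.1) (Learns.of_eventually C hx ha
      (eventually_refs_of_target_subset C hr.irrefl hl.1 (hr.mem a b hab hl.2.1)))
      (aware_impl hl.2.2)
  rcases aware_or_forwarded C hab h with ⟨j, hj⟩ | ⟨l, hl⟩
  · obtain ⟨l, hl, hlu, hlt⟩ := Learns.exists_probe C hx hax ha j
    rcases refs_or_forwarded C hab hl hj with h | ⟨l, hl⟩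
    · exact Learns.of_reply C hx hlu hlt h
    · exact hfwd l hl
  · exact hfwd l hl

/-- Edges can also be followed backwards, because nodes introduce themselves when probing. If `a`
stores `b` at a Timeout, then `b` becomes aware of `a`. If `a` forwards `b` instead, induction shows
that `x` learns the next hop, which `a` keeps probing. -/
theorem Learns.of_aware_of_learns {a b : V} {i : ℕ} (hab : b ≠ a) (hb : Learns C x b)
    (h : Aware (C.state i) a b) : Learns C x a := by
  let r : V → V → Prop := fun a' a => δ a' b < δ a b
  have : IsTrans V r := ⟨fun _ _ _ h h' => lt_trans (b := δ _ b) h h'⟩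
  have : Std.Irrefl r := ⟨fun _ => lt_irrefl (δ _ b)⟩
  induction a using (Finite.wellFounded_of_trans_of_irrefl r).induction generalizing i with
  | _ a ih =>
  have hfwd : ∀ l, Forwarded C l a b → Learns C x a := by
    intro l hl
    have hm := hr.mem a b hab hl.2.1
    have hha : hop a b ≠ a := fun h => hr.irrefl a (by rwa [h] at hm)
    have hbh : b ≠ hop a b := fun h => hl.2.1 (by rwa [← h] at hm)
    have hh : Learns C x (hop a b) :=
      ih (hop a b) (hδ a b hab hl.2.1) hbh (aware_impl hl.2.2)
    obtain ⟨n, hn⟩ := eventually_atTop.1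
      (eventually_refs_of_target_subset C hr.irrefl hl.1 hm)
    obtain ⟨j, hj, hju, hjt⟩ := timeout_executed C a n
    exact Learns.trans_aware C hx hr hδ hh
      (aware_impl (aware_of_probe C hha hju hjt (hn j hj)))
  rcases aware_or_forwarded C hab h with ⟨j, hj⟩ | ⟨l, hl⟩
  · obtain ⟨l, hl, hlu, hlt⟩ := timeout_executed C a j
    rcases refs_or_forwarded C hab hl hj with h | ⟨l, hl⟩
    · exact Learns.trans_aware C hx hr hδ hb (aware_impl (aware_of_probe C hab hlu hlt h))
    · exact hfwd l hl
  · exact hfwd l hl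

theorem learns_everything (hC : (network N hop).WeaklyConnected (C.state 0)) (b : V) :
    Learns C x b := by
  -- The set of learned nodes is closed under initial edges in both directions, so weak connectivity
  -- makes it everything.
  have key : ∀ a b, EqvGen ((network N hop).NG (C.state 0)) a b →
      (Learns C x a ↔ Learns C x b) := by
    intro a b h
    induction h with
    | rel a b h =>
      exact ⟨fun ha => Learns.trans_aware C hx hr hδ ha h.2,
        fun hb => Learns.of_aware_of_learns C hx hr hδ h.1.symm hb h.2⟩
    | refl => exact .rfl
    | symm _ _ _ ih => exact ih.symm
    | trans _ _ _ _ _ ih ih' => exact ih.trans ih'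
  exact (key x b (hC x b)).1 (.inl rfl)

omit hx in
/-- In a computation from a weakly connected state every node gets to know its target neighbours. -/
theorem exists_target_subset (hC : (network N hop).WeaklyConnected (C.state 0)) (u : V) :
    ∃ i, N u ⊆ ((C.state i).loc u).refs := by
  by_contra! hx
  -- A node that is never complete never drops what it has learned, so at some time it holds all of
  -- `N u` at once.
  have h : ∀ᶠ i in atTop, ∀ b : V, b ∈ N u → b ∈ ((C.state i).loc u).refs :=
    eventually_all.2 fun b => eventually_imp_distrib_left.2 fun hb =>
      Learns.eventually C hx (by rintro rfl; exact hr.irrefl _ hb)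
        (learns_everything C hx hr hδ hC b)
  obtain ⟨i, hi⟩ := h.exists
  exact hx i hi

end Convergence

/-! ### Legitimate states, self-stabilization and the stable MDL property. -/

section Legitimate

set_option linter.unusedSectionVars false

variable {V : Type} [DecidableEq V] {N : V → Finset V} {hop : V → V → V} {D : V → V → V → Prop}
  {δ : V → V → ℝ} {T : Digraph V}

theorem mem_stable_iff {u v : V} {s : Memory V} :
    v ∈ stable N u s ↔ v ∈ s.refs ∧ (N u ⊆ s.refs → v ∈ N u) := by
  unfold stable
  split_ifs with h <;> simp [h]

/-- The legitimate states: all nodes know their target neighbours, and nothing is left to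
delegate. -/
def legitimate (N : V → Finset V) (hop : V → V → V) : Set (network N hop).State :=
  {S | Quiet S ∧ ∀ u, N u ⊆ (S.loc u).refs}

/-- Quietness sustains itself: a request needs a temporary edge, an acknowledgement needs a request,
and a complete node gains a new edge only through a request. -/
theorem legitimate_step (hN : ∀ u, u ∉ N u) {S S' : (network N hop).State}
    (hS : S ∈ legitimate N hop) (h : (network N hop).Step S S') : S' ∈ legitimate N hop := by
  obtain ⟨u, t, h⟩ := h
  refine ⟨⟨fun v x w n k hm => ?_, fun v w n k hm => ?_, fun a w hw => ?_⟩,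
    fun a => step_target_subset hN h (hS.2 a)⟩
  · rcases step_mem_ch h hm with hm | hm
    · exact hS.1.no_req _ _ _ _ _ hm
    · exact hS.1.no_temporary _ _ (req_sent hm).1
  · rcases step_mem_ch h hm with hm | hm
    · exact hS.1.no_ack _ _ _ _ hm
    · obtain ⟨k', rfl⟩ := ack_sent hm
      exact hS.1.no_req _ _ _ _ _ (step_message_mem h)
  · by_cases hau : a = u
    · subst hau
      obtain ⟨-, h1, h2, h3⟩ := mem_temporary.1 hw
      rw [step_loc h] at h2
      rcases stored_on_request (hS.2 a) h2 with h4 | ⟨x, n, k, rfl⟩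
      · exact hS.1.no_temporary a w (mem_temporary.2 ⟨hS.2 a, h1, h4, h3⟩)
      · exact hS.1.no_req _ _ _ _ _ (step_message_mem h)
    · rw [step_loc_of_ne h hau] at hw
      exact hS.1.no_temporary _ _ hw

theorem legitimate_reachable (hN : ∀ u, u ∉ N u) {S S' : (network N hop).State}
    (hS : S ∈ legitimate N hop) (h : (network N hop).Reachable S S') :
    S' ∈ legitimate N hop := by
  induction h with
  | refl => exact hS
  | tail _ h ih => exact legitimate_step hN ih h

theorem selfStabilizes [Finite V] (hr : IsRouting N hop D)
    (hδ : ∀ u w, w ≠ u → w ∉ N u → δ (hop u w) w < δ u w)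
    (hT : ∀ u w, w ∈ N u ↔ u ≠ w ∧ T.Adj u w) :
    (network N hop).SelfStabilizesTo T (legitimate N hop) where
  topology S hS u v := by
    rw [← hT]
    constructor
    · rintro ⟨huv, h⟩
      by_contra hv
      exact hS.1.no_temporary u v (mem_temporary.2 ⟨hS.2 u, huv.symm, h, hv⟩)
    · exact fun h => ⟨((hT u v).1 h).1, hS.2 u h⟩
  convergence C hC := by
    have h1 : ∀ᶠ i in Filter.atTop, ∀ u, N u ⊆ ((C.state i).loc u).refs :=
      Filter.eventually_all.2 fun u => by
        obtain ⟨i, hi⟩ := exists_target_subset C hr hδ hC u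
        exact Filter.eventually_atTop.2
          ⟨i, fun j hj => target_subset_mono C hr.irrefl hj hi⟩
    exact ((eventually_quiet C hr hδ).and h1).exists
  closure S hS S' h := legitimate_step hr.irrefl hS h

/-- In legitimate states messages with references are forwarded to the next hop. -/
theorem legitimate_sends {S : (network N hop).State} (hS : S ∈ legitimate N hop) {u v : V}
    {m : Message V} (hm : m ∈ S.ch u) (hv : v ∈ (network N hop).refsOf m) (hvu : v ≠ u)
    (hst : v ∉ stable N u (S.loc u)) : v ∉ N u ∧
      ∀ q : V × Message V, (q ∈ (react N hop u (S.loc u) (.message m)).sends ∧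
        v ∈ (network N hop).refsOf q.2) ↔ q = (hop u v, .impl v false) := by
  have hvN : v ∉ N u := fun h => hst (mem_stable_iff.2 ⟨hS.2 u h, fun _ => h⟩)
  refine ⟨hvN, fun q => ?_⟩
  match m with
  | .other p => exact p.elim
  | .req x w n k => exact absurd hm (hS.1.no_req _ _ _ _ _)
  | .ack w n k => exact absurd hm (hS.1.no_ack _ _ _ _)
  | .impl w k =>
    obtain rfl : v = w := by simpa [SafeMsg.refsOf] using hv
    have hf : forward N hop u (S.loc u) v = {(hop u v, .impl v false)} := by
      simp [forward, hS.2 u, hvN, hvu]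
    constructor
    · rintro ⟨h, hq⟩
      rcases Multiset.mem_add.1 h with h | h
      · rw [hf] at h
        exact Multiset.mem_singleton.1 h
      · cases k
        · simp at h
        -- The reply to a probe of `v` omits the reference of `v` itself, so only the forwarded
        -- message carries it.
        · obtain ⟨z, hz, rfl⟩ := Multiset.mem_map.1 h
          rw [Finset.mem_val, Finset.mem_erase] at hz
          exact absurd (by simpa [SafeMsg.refsOf] using hq : v = z).symm hz.1
    · rintro rfl
      refine ⟨Multiset.mem_add.2 (.inl ?_), by simp [SafeMsg.refsOf]⟩
      rw [hf]
      exact Multiset.mem_singleton_self _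

theorem forwards_eq (hN : ∀ u, u ∉ N u) {S : (network N hop).State}
    (hS : S ∈ legitimate N hop) {v : V} {p q : V × Message V} (hvp : v ≠ p.1)
    (h : (network N hop).Forwards (stable N) S v p q) :
    v ∉ N p.1 ∧ q = (hop p.1 v, .impl v false) := by
  obtain ⟨S', hS', hp, hv, hst, o, hy, hq, hvq⟩ := h
  have h1 := legitimate_sends (legitimate_reachable hN hS hS') hp hv hvp hst
  rw [yields_iff.1 hy] at hq
  exact ⟨h1.1, (h1.2 q).1 ⟨hq, hvq⟩⟩

theorem forwards_star (hr : IsRouting N hop D) {S : (network N hop).State}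
    (hS : S ∈ legitimate N hop) {v : V} {p q : V × Message V} (hvp : v ≠ p.1)
    (hv : v ∈ (network N hop).refsOf p.2)
    (h : ReflTransGen ((network N hop).Forwards (stable N) S v) p q) :
    v ≠ q.1 ∧ v ∈ (network N hop).refsOf q.2 := by
  induction h with
  | refl => exact ⟨hvp, hv⟩
  | tail _ h ih =>
    obtain ⟨h1, rfl⟩ := forwards_eq hr.irrefl hS ih.1 h
    refine ⟨fun h2 => h1 ?_, by simp [SafeMsg.refsOf]⟩
    have h3 := hr.mem _ v ih.1 h1
    rwa [show hop _ v = v from h2.symm] at h3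

/-- Each forwarding goes to the next hop, so the distance to `v` is a potential that excludes
cycles. -/
theorem forwards_closer (hr : IsRouting N hop D)
    (hδ : ∀ u w, w ≠ u → w ∉ N u → δ (hop u w) w < δ u w) {S : (network N hop).State}
    (hS : S ∈ legitimate N hop) {v : V} {p q : V × Message V} (hvp : v ≠ p.1)
    (hv : v ∈ (network N hop).refsOf p.2)
    (h : TransGen ((network N hop).Forwards (stable N) S v) p q) : δ q.1 v < δ p.1 v := by
  induction h with
  | single h =>
    obtain ⟨h1, rfl⟩ := forwards_eq hr.irrefl hS hvp h
    exact hδ _ _ hvp h1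
  | tail h0 h ih =>
    have h2 := (forwards_star hr hS hvp hv h0.to_reflTransGen).1
    obtain ⟨h1, rfl⟩ := forwards_eq hr.irrefl hS h2 h
    exact (hδ _ _ h2 h1).trans ih

theorem mem_sentRefs {P : Protocol V} {o : P.Out} {y v : V} :
    (y, v) ∈ P.sentRefs o ↔ ∃ q ∈ o.sends, v ∈ P.refsOf q.2 ∧ q.1 = y := by
  simp [Protocol.sentRefs]

theorem mem_of_mem_held {P : Protocol V} {u v : V} {t : P.Trig} {s : P.Local} (hvu : v ≠ u)
    (h : v ∈ P.held u t s) : v ∈ s.refs ∨ v ∈ P.triggerRefs t := by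
  simpa [Protocol.held, hvu, -Finset.erase_val] using h

theorem mdlCore (hr : IsRouting N hop D)
    (hδ : ∀ u w, w ≠ u → w ∉ N u → δ (hop u w) w < δ u w)
    (hT : ∀ u w, w ∈ N u ↔ u ≠ w ∧ T.Adj u w) :
    (network N hop).MDLCore (stable N) T (legitimate N hop) where
  keeps_topology C i v hv hh hTv := by
    have hvN := (hT _ _).2 ⟨hv.symm, hTv⟩
    have h := (kept_or_forwarded (N := N) (hop := hop) hv (mem_of_mem_held hv hh)).resolve_right
      fun h => h.2.1 hvN
    rw [← step_loc (C.step i)] at h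
    exact mem_stable_iff.2 ⟨h, fun _ => hvN⟩
  monotone C i j v hij hu hv hh hns _ := by
    -- Incomplete nodes count everything as stable, so a reference is denied only by a complete node
    -- and only outside its target neighbourhood. Completeness persists, and with it the denial.
    have key : N (C.node i) ⊆ ((C.state (i + 1)).loc (C.node i)).refs ∧ v ∉ N (C.node i) := by
      rcases kept_or_forwarded (N := N) (hop := hop) hv (mem_of_mem_held hv hh) with h | h
      · rw [← step_loc (C.step i)] at h
        by_contra hcon
        exact hns (mem_stable_iff.2 ⟨h, fun hd => by_contra fun hvN => hcon ⟨hd, hvN⟩⟩)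
      · exact ⟨step_target_subset hr.irrefl (C.step i) h.1, h.2.1⟩
    rw [← hu]
    exact fun h => key.2 ((mem_stable_iff.1 h).2
      (target_subset_mono C hr.irrefl (by omega : i + 1 ≤ j + 1) key.1))
  deterministic u t s o o' h h' := by rw [yields_iff.1 h, yields_iff.1 h']
  cycle_free S hS u m v hm hv hvu q r hq hqr heq := by
    obtain ⟨h1, h2⟩ := forwards_star (p := (u, m)) hr hS hvu hv hq
    have h3 := forwards_closer hr hδ hS h1 h2 hqr
    rw [heq] at h3
    exact lt_irrefl _ h3
  fixed_paths S hS u m v hm hv hvu q hq := by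
    obtain ⟨h1, h2⟩ := forwards_star (p := (u, m)) hr hS hvu hv hq
    refine ⟨h1.symm, {hop q.1 v}, Set.singleton_nonempty _, fun S' hS' hm' hst o hy y => ?_⟩
    have h3 := (legitimate_sends (legitimate_reachable hr.irrefl hS hS') hm' h2 h1 hst).2
    rw [yields_iff.1 hy, mem_sentRefs, Set.mem_singleton_iff]
    constructor
    · rintro ⟨p, hp, hvp, rfl⟩
      rw [(h3 p).1 ⟨hp, hvp⟩]
    · rintro rfl
      obtain ⟨h4, h5⟩ := (h3 _).2 rfl
      exact ⟨_, h4, h5, rfl⟩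

end Legitimate

end Routed

/-! ### The transformation and its routing. -/

section Transformation

variable {V : Type} [Fintype V] [DecidableEq V] (ident : V → ℕ) (dist : ℕ → ℕ → ℝ)

open Classical in
/-- A permanent neighbour of `u` to which its edge to `w` may be delegated. -/
noncomputable def delegate (A : Protocol V) (u w : V) : V :=
  if h : ∃ v ∈ A.permanent u, Closer ident dist u v w then h.choose else u

/-- The protocol that results from `A` when Delegation is replaced by Safe-Delegation.  A node makes
those references stable that `A` never gives up, and delegates the other ones to the permanent
neighbours that are closer to them.  Whether `A` drops a reference in a particular state may depend on
the history that its variables record, and the edge which Safe-Delegation retains until the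
acknowledgement has no counterpart in `A`; therefore the decision is taken for all memories at once. -/
noncomputable def safeTransform (A : Protocol V) : SafeProtocol V :=
  Routed.safeProtocol A.permanent (delegate ident dist A)

variable {ident dist} {A : Protocol V} {T : Digraph V} {L : Set A.State}

theorem delegate_spec (hA : A.SelfStabilizesTo T L) (hm : A.MDL ident dist T L) {u w : V}
    (hwu : w ≠ u) (hw : w ∉ A.permanent u) : delegate ident dist A u w ∈ A.permanent u ∧
      Closer ident dist u (delegate ident dist A u w) w := by
  have h := Protocol.exists_closer_permanent hA hm hwu hw
  rw [delegate, dif_pos h]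
  exact h.choose_spec

theorem isRouting_delegate (hA : A.SelfStabilizesTo T L) (hm : A.MDL ident dist T L) :
    Routed.IsRouting A.permanent (delegate ident dist A) (Closer ident dist) :=
  ⟨A.notMem_permanent_self, fun _ _ h h' => (delegate_spec hA hm h h').1,
    fun _ _ h h' => (delegate_spec hA hm h h').2⟩

end Transformation

end Overlay

theorem mainTheorem2 {V : Type} [Fintype V] [DecidableEq V]
    (ident : V → ℕ) (hident : Function.Injective ident)
    (dist : ℕ → ℕ → ℝ) (hdist : ∀ a b : ℕ, a ≠ b → dist b b < dist a b) :
    ∃ transform : Overlay.Protocol V → Overlay.SafeProtocol V,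
      ∀ (A : Overlay.Protocol V) (T : Digraph V) (L : Set A.State),
        A.InPIDF → Overlay.StronglyConnected T → A.SelfStabilizesTo T L →
        A.MDL ident dist T L →
        (transform A).InPISF ∧
        (∃ L' : Set (transform A).toProtocol.State,
          (transform A).StableMDL ident dist T L' ∧
          (transform A).toProtocol.SelfStabilizesTo T L') ∧
        ∀ C : (transform A).toProtocol.Computation, ∃ N : ℕ, ∀ i : ℕ, N ≤ i →
          (transform A).Invariant1 (C.state i) ∧ (transform A).Invariant2 (C.state i) := by
  refine ⟨Overlay.safeTransform ident dist, fun A T L _ _ hA hm => ?_⟩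
  have hr := Overlay.isRouting_delegate hA hm
  -- Condition (v) for the target identifier of `w` itself: `w` is at the least distance from it, so
  -- the delegate has to be strictly closer than `u`.
  have hδ : ∀ u w, w ≠ u → w ∉ A.permanent u →
      dist (ident (Overlay.delegate ident dist A u w)) (ident w) < dist (ident u) (ident w) :=
    fun u w h h' => hr.delegable u w h h' _ (hdist _ _ fun h'' => h (hident h'').symm)
  have hT := fun u w => Overlay.Protocol.mem_permanent_iff (u := u) (w := w) hA hm.1
  refine ⟨Overlay.Routed.inPISF hr, ⟨Overlay.Routed.legitimate _ _,
    ⟨Overlay.Routed.mdlCore (δ := fun u w => dist (ident u) (ident w)) hr hδ hT,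
      Overlay.Routed.decomposable hr⟩,
    Overlay.Routed.selfStabilizes (δ := fun u w => dist (ident u) (ident w)) hr hδ hT⟩,
    fun C => ?_⟩
  obtain ⟨n, hn⟩ := Filter.eventually_atTop.1 (Overlay.Routed.eventually_quiet
    (δ := fun u w => dist (ident u) (ident w)) C hr hδ)
  -- Once the system is quiet, no message is left about which the invariants could make a claim.
  exact ⟨n, fun i hi => ⟨fun v u w n k h => absurd h ((hn i hi).no_req v u w n k),
    fun u w n k h => absurd h ((hn i hi).no_ack u w n k)⟩⟩
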